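/- Let $\hbar,m_0,Y,\tau>0$, $0<X_0<X$, $V_\infty\in\mathbb R$, $c_\hbar=\hbar^2/(2m_0)$. Let $J,K\ge1$ be integers, $h_x=X/J\le X-X_0$, $h_y=Y/K$, $x_j=jh_x$, $y_k=kh_y$. Let $V(x,y)$ and $\tilde V(x)$ be real functions with $V(x,y)=V_\infty$ for $x\ge X_0$, $0<y<Y$, and $\tilde V(x)=V_\infty$ for $x\ge X_0$; put $\Delta V=V-\tilde V$. Let $\overline\omega_h=\{(x_j,y_k):0\le j\le J,\ 0\le k\le K\}$, $\omega_h=\{1\le j\le J-1,\ 1\le k\le K-1\}$, $\Gamma_{1h}=\{j=J,\ 1\le k\le K-1\}$, $\Gamma_h=\overline\omega_h\setminus(\omega_h\cup\Gamma_{1h})$. Let $\bar\partial_x,\partial_x,\bar\partial_y,\partial_y$ be the backward and forward difference quotients, $s_{Nx}=I+\frac{h_x^2}{12}\partial_x\bar\partial_x$, $s_{Ny}=I+\frac{h_y^2}{12}\partial_y\bar\partial_y$, $s_N=I+\frac{h_x^2}{12}\partial_x\bar\partial_x+\frac{h_y^2}{12}\partial_y\bar\partial_y$, $\Delta_{hN}=s_{Ny}\partial_x\bar\partial_x+s_{Nx}\partial_y\bar\partial_y$,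 $s^-_{\theta x}W_j=\theta W_{j-1}+(\frac12-\theta)W_j$, and $Z^{(q)}=\frac2K\sum_{k=1}^{K-1}Z_k\sin\frac{\pi qk}{K}$. Given mesh functions $F^m$ $(m\ge1)$ on $\omega_h$ and $\Psi^0_h$ on $\overline\omega_h$ with $\Psi^0_h|_{\Gamma_h}=0$, consider the splitting Numerov–Crank–Nicolson scheme: for all $m\ge1$, $$i\hbar\frac{\breve\Psi^m-\Psi^{m-1}}{\tau/2}=\Delta V\frac{\breve\Psi^m+\Psi^{m-1}}2\ \text{ on }\omega_h\cup\Gamma_{1h},$$ $$i\hbar s_N\frac{\tilde\Psi^m-\breve\Psi^m}{\tau}=-c_\hbar\Delta_{hN}\frac{\tilde\Psi^m+\breve\Psi^m}2+s_N\Bigl(\tilde V\frac{\tilde\Psi^m+\breve\Psi^m}2\Bigr)+F^m\ \text{ on }\omega_h,$$ $$i\hbar\frac{\Psi^m-\tilde\Psi^m}{\tau/2}=\Delta V\frac{\Psi^m+\tilde\Psi^m}2\ \text{ on }\omega_h\cup\Gamma_{1h},$$ $\breve\Psi^m=\tilde\Psi^m=\Psi^m=0$ on $\Gamma_h$, $\Psi^0=\Psi^0_h$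 on $\overline\omega_h$, and the discrete transparent boundary condition, for $1\le q\le K-1$ (with $\tilde\Psi^0:=\Psi^0_h$), $$\Bigl[c_{\hbar,q}\bar\partial_x\frac{\tilde\Psi^{m(q)}+\breve\Psi^{m(q)}}2-h_xs^-_{\theta_qx}\Bigl(i\hbar\frac{\tilde\Psi^{m(q)}-\breve\Psi^{m(q)}}\tau-V_{\infty,q}\frac{\breve\Psi^{m(q)}+\tilde\Psi^{m(q)}}2\Bigr)\Bigr]\Big|_{j=J}=c_{\hbar,q}\sum_{p=0}^mR_q^p\,\tilde\Psi_J^{m-p\,(q)}.$$ Here $\lambda_q=\bigl(\frac2{h_y}\sin\frac{\pi qh_y}{2Y}\bigr)^2$, $\sigma_q=1-\frac{h_y^2}{12}\lambda_q$, $c_{\hbar,q}=c_\hbar\bigl[1+\bigl(\frac{h_xh_y\lambda_q}{12\sigma_q}\bigr)^2\bigr]$, $\theta_q=\frac1{12\sigma_q}$, $V_{\infty,q}=V_\infty+c_\hbar\frac{\lambda_q}{\sigma_q}$, and $$R_q^0=c_{1q},\quad R_q^1=-c_{1q}\varkappa_q\mu_q,\quad R_q^m=\tfrac{2m-3}m\varkappa_q\mu_qR_q^{m-1}-\tfrac{m-3}m\varkappa_q^2R_q^{m-2}\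 (m\ge2),$$ with $c_{1q}=-\frac{|\alpha_q|^{1/2}}2e^{-i(\arg\alpha_q)/2}$, $\varkappa_q=-e^{i\arg\alpha_q}$, $\arg\alpha_q\in(0,2\pi)$, $\mu_q=\beta_q/|\alpha_q|$, $\alpha_q=2a_q+(1-4\theta_q)h_x^2a_q^2$, $\beta_q=2\operatorname{Re}a_q+(1-4\theta_q)h_x^2|a_q|^2$, $a_q=\frac{V_{\infty,q}}{2c_{\hbar,q}}+i\frac{\hbar}{\tau c_{\hbar,q}}$. Assume that for some real $L$ and some $\alpha\in[0,1]$ one has $|\tilde V(x')-\tilde V(x)|\le L|x'-x|^\alpha$ for all $0\le x\le x'\le X$ (for $\alpha=0$ the right-hand side is $L$), and that $L\tau h_x^\alpha<8\hbar$. Then the scheme has a solution, and it is unique on $\overline\omega_h$. If moreover $\Psi^0_h=0$ on $\Gamma_{1h}$ and $\Psi^0_h|_{j=J-1}=0$, then for every $M\ge1$ $$\max_{0\le m\le M}\|\Psi^m\|_{\widetilde\omega_h}\le\|\Psi^0_h\|_{\widetilde\omega_h}+\frac6\hbar\sum_{m=1}^M\|F^m\|_{\omega_h}\tau,$$ where $\|W\|_{\widetilde\omega_h}^2=\sum_{j=1}^{J}\sum_{k=1}^{K-1}|W_{j,k}|^2h_xh_y$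 and $\|W\|_{\omega_h}^2=\sum_{j=1}^{J-1}\sum_{k=1}^{K-1}|W_{j,k}|^2h_xh_y$. -/

import Mathlib

noncomputable section

namespace SplitNumerov

/-- A mesh function in space: `W j k` is its value at the node `(x_j, y_k) = (j h_x, k h_y)`.
Only the values at nodes of the mesh that is under consideration are ever used. -/
abbrev MeshFun := ℕ → ℕ → ℂ

/-! ### One-dimensional difference operators -/

/-- Backward difference quotient `(Z_i - Z_{i-1}) / h` (used at indices `i ≥ 1` only). -/
def bwd (h : ℝ) (Z : ℕ → ℂ) (i : ℕ) : ℂ := (Z i - Z (i - 1)) / h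

/-- Forward difference quotient `(Z_{i+1} - Z_i) / h`. -/
def fwd (h : ℝ) (Z : ℕ → ℂ) (i : ℕ) : ℂ := (Z (i + 1) - Z i) / h

/-- The one-sided average `θ Z_{i-1} + (1/2 - θ) Z_i` (used at indices `i ≥ 1` only). -/
def sMinus (θ : ℝ) (Z : ℕ → ℂ) (i : ℕ) : ℂ := θ * Z (i - 1) + (1 / 2 - θ) * Z i

/-! ### Two-dimensional difference operators (used at interior nodes only) -/

/-- `∂_x ∂̄_x`. -/
def dxx (hx : ℝ) (W : MeshFun) : MeshFun := fun j k => fwd hx (bwd hx (fun i => W i k)) j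

/-- `∂_y ∂̄_y`. -/
def dyy (hy : ℝ) (W : MeshFun) : MeshFun := fun j k => fwd hy (bwd hy (W j)) k

/-- Numerov average in `x`. -/
def sNx (hx : ℝ) (W : MeshFun) : MeshFun := fun j k => W j k + hx ^ 2 / 12 * dxx hx W j k

/-- Numerov average in `y`. -/
def sNy (hy : ℝ) (W : MeshFun) : MeshFun := fun j k => W j k + hy ^ 2 / 12 * dyy hy W j k

/-- Two-dimensional Numerov average `s_N = I + (h_x²/12) ∂_x ∂̄_x + (h_y²/12) ∂_y ∂̄_y`. -/
def sN (hx hy : ℝ) (W : MeshFun) : MeshFun := fun j k =>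
  W j k + hx ^ 2 / 12 * dxx hx W j k + hy ^ 2 / 12 * dyy hy W j k

/-- Numerov-type Laplacian `Δ_{hN} = s_{Ny} ∂_x ∂̄_x + s_{Nx} ∂_y ∂̄_y`. -/
def lapN (hx hy : ℝ) (W : MeshFun) : MeshFun := fun j k =>
  sNy hy (dxx hx W) j k + sNx hx (dyy hy W) j k

/-- Discrete Fourier sine coefficient `Z^{(q)} = (2/K) ∑_{k=1}^{K-1} Z_k sin(π q k / K)`. -/
def sineCoeff (K : ℕ) (Z : ℕ → ℂ) (q : ℕ) : ℂ :=
  2 / (K : ℂ) * ∑ k ∈ Finset.Icc 1 (K - 1), Z k * (Real.sin (Real.pi * q * k / K) : ℂ)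

/-- Discrete convolution `(R * Q)^m = ∑_{p=0}^m R^p Q^{m-p}`. -/
def conv (R Q : ℕ → ℂ) (m : ℕ) : ℂ := ∑ p ∈ Finset.range (m + 1), R p * Q (m - p)

/-- The argument of a complex number taken in `(0, 2π]`. -/
def argPos (z : ℂ) : ℝ := if 0 < z.arg then z.arg else z.arg + 2 * Real.pi

/-! ### The problem data -/

/-- Physical constants, potentials and mesh parameters. The potential `V` and the auxiliary
one-dimensional potential `Vt` are equal to the constant `Vinf` for `x ≥ X0`. -/
structure Setup where
  /-- the constant `ħ` -/
  hbar : ℝ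
  /-- the mass `m₀` -/
  m0 : ℝ
  /-- the beginning of the zone of constant potential -/
  X0 : ℝ
  /-- position of the artificial boundary -/
  X : ℝ
  /-- width of the strip -/
  Y : ℝ
  /-- the value of the potential far away -/
  Vinf : ℝ
  /-- the potential -/
  V : ℝ → ℝ → ℝ
  /-- the auxiliary potential -/
  Vt : ℝ → ℝ
  /-- number of mesh steps in `x` on `[0, X]` -/
  J : ℕ
  /-- number of mesh steps in `y` on `[0, Y]` -/
  K : ℕ
  /-- the time step -/
  tau : ℝ
  hbar_pos : 0 < hbar
  m0_pos : 0 < m0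
  X0_pos : 0 < X0
  X0_lt_X : X0 < X
  Y_pos : 0 < Y
  J_pos : 0 < J
  K_pos : 0 < K
  tau_pos : 0 < tau
  hx_le : X / J ≤ X - X0
  V_far : ∀ x y, X0 ≤ x → 0 < y → y < Y → V x y = Vinf
  Vt_far : ∀ x, X0 ≤ x → Vt x = Vinf

namespace Setup

variable (P : Setup)

/-- Space step in `x`. -/
def hx : ℝ := P.X / P.J

/-- Space step in `y`. -/
def hy : ℝ := P.Y / P.K

/-- `c_ħ = ħ² / (2 m₀)`. -/
def c : ℝ := P.hbar ^ 2 / (2 * P.m0)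

/-- The auxiliary potential at the node `x_j`. -/
def VtMesh (j : ℕ) : ℝ := P.Vt (j * P.hx)

/-- The difference `ΔV = V - Ṽ` of the potentials at the node `(x_j, y_k)`. -/
def dV (j k : ℕ) : ℝ := P.V (j * P.hx) (k * P.hy) - P.VtMesh j

/-- Multiplication of a mesh function by the auxiliary potential. -/
def mulVt (W : MeshFun) : MeshFun := fun j k => P.VtMesh j * W j k

/-! ### Coefficients of the discrete transparent boundary condition -/

/-- Eigenvalue of `-∂_y ∂̄_y`. -/
def lam (q : ℕ) : ℝ := (2 / P.hy * Real.sin (Real.pi * q * P.hy / (2 * P.Y))) ^ 2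

/-- Eigenvalue of `s_{Ny}`. -/
def sig (q : ℕ) : ℝ := 1 - P.hy ^ 2 / 12 * P.lam q

/-- `c_{ħ,q}`. -/
def cq (q : ℕ) : ℝ := P.c * (1 + (P.hx * P.hy * P.lam q / (12 * P.sig q)) ^ 2)

/-- `θ_q`. -/
def theta (q : ℕ) : ℝ := 1 / (12 * P.sig q)

/-- `V_{∞,q}`. -/
def Vinfq (q : ℕ) : ℝ := P.Vinf + P.c * (P.lam q / P.sig q)

/-- `a_q`. -/
def aq (q : ℕ) : ℂ :=
  ((P.Vinfq q / (2 * P.cq q) : ℝ) : ℂ) + Complex.I * ((P.hbar / (P.tau * P.cq q) : ℝ) : ℂ)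

/-- `α_q`. -/
def alphaq (q : ℕ) : ℂ :=
  2 * P.aq q + (1 - 4 * P.theta q) * P.hx ^ 2 * P.aq q ^ 2

/-- `β_q`. -/
def betaq (q : ℕ) : ℝ :=
  2 * (P.aq q).re + (1 - 4 * P.theta q) * P.hx ^ 2 * ‖P.aq q‖ ^ 2

/-- `ϰ_q = -e^{i arg α_q}`. -/
def kappaq (q : ℕ) : ℂ := -Complex.exp (Complex.I * argPos (P.alphaq q))

/-- `μ_q = β_q / |α_q|`. -/
def muq (q : ℕ) : ℝ := P.betaq q / ‖P.alphaq q‖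

/-- `c_{1q} = -(|α_q|^{1/2} / 2) e^{-i (arg α_q) / 2}`. -/
def c1q (q : ℕ) : ℂ :=
  -((Real.sqrt ‖P.alphaq q‖ / 2 : ℝ) : ℂ) * Complex.exp (-Complex.I * argPos (P.alphaq q) / 2)

/-- The convolution kernel `R_q^m`; in the last line `m = n + 2`, so that the coefficients are
`(2m-3)/m` and `(m-3)/m`. -/
def R (q : ℕ) : ℕ → ℂ
  | 0 => P.c1q q
  | 1 => -P.c1q q * P.kappaq q * P.muq q
  | n + 2 =>
      (2 * ((n : ℂ) + 2) - 3) / ((n : ℂ) + 2) * P.kappaq q * P.muq q * R q (n + 1)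
        - (((n : ℂ) + 2) - 3) / ((n : ℂ) + 2) * P.kappaq q ^ 2 * R q n

/-! ### Parts of the finite mesh -/

/-- `(x_j, y_k)` is a node of the finite mesh `ω̄_h`. -/
def onMesh (j k : ℕ) : Prop := j ≤ P.J ∧ k ≤ P.K

/-- `(x_j, y_k)` belongs to the interior `ω_h`. -/
def interior (j k : ℕ) : Prop := 1 ≤ j ∧ j ≤ P.J - 1 ∧ 1 ≤ k ∧ k ≤ P.K - 1

/-- `(x_j, y_k)` belongs to the artificial boundary `Γ_{1h}`. -/
def artificial (j k : ℕ) : Prop := j = P.J ∧ 1 ≤ k ∧ k ≤ P.K - 1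

/-- `(x_j, y_k)` belongs to `Γ_h`, the rest of the boundary. -/
def dirichlet (j k : ℕ) : Prop :=
  P.onMesh j k ∧ ¬ P.interior j k ∧ ¬ P.artificial j k

/-! ### The norms -/

/-- `(∑_{j=1}^{J-1} ∑_{k=1}^{K-1} |W_{j,k}|² h_x h_y)^{1/2}`. -/
def normInt (W : MeshFun) : ℝ :=
  Real.sqrt (∑ j ∈ Finset.Icc 1 (P.J - 1), ∑ k ∈ Finset.Icc 1 (P.K - 1),
    ‖W j k‖ ^ 2 * P.hx * P.hy)

/-- `(∑_{j=1}^{J} ∑_{k=1}^{K-1} |W_{j,k}|² h_x h_y)^{1/2}`. -/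
def normTilde (W : MeshFun) : ℝ :=
  Real.sqrt (∑ j ∈ Finset.Icc 1 P.J, ∑ k ∈ Finset.Icc 1 (P.K - 1),
    ‖W j k‖ ^ 2 * P.hx * P.hy)

/-! ### The scheme -/

/-- One half-step with the potential `ΔV`, from `A` to `B`:
`iħ (B - A) / (τ/2) = ΔV (B + A) / 2` on `ω_h ∪ Γ_{1h}`. -/
def PotentialStep (A B : MeshFun) : Prop :=
  ∀ j k, P.interior j k ∨ P.artificial j k →
    Complex.I * P.hbar * ((B j k - A j k) / (P.tau / 2)) = P.dV j k * ((B j k + A j k) / 2)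

/-- The main step from `A` to `B` with the free term `G`:
`iħ s_N (B - A)/τ = -c_ħ Δ_{hN} (B + A)/2 + s_N (Ṽ (B + A)/2) + G` on `ω_h`. -/
def MainStep (A B G : MeshFun) : Prop :=
  ∀ j k, P.interior j k →
    Complex.I * P.hbar * sN P.hx P.hy (fun j k => (B j k - A j k) / P.tau) j k =
      -P.c * lapN P.hx P.hy (fun j k => (B j k + A j k) / 2) j k
        + sN P.hx P.hy (P.mulVt (fun j k => (B j k + A j k) / 2)) j k
        + G j k

/-- The discrete transparent boundary condition at `j = J` on the time level `m`, for the
Fourier coefficients `1 ≤ q ≤ K - 1` of `br = Ψ̆` and `tl = Ψ̃`. -/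
def TBC (br tl : ℕ → MeshFun) (m : ℕ) : Prop :=
  ∀ q, 1 ≤ q → q ≤ P.K - 1 →
    P.cq q * bwd P.hx
        (fun j => (sineCoeff P.K (tl m j) q + sineCoeff P.K (br m j) q) / 2) P.J
      - P.hx * sMinus (P.theta q)
        (fun j =>
          Complex.I * P.hbar * ((sineCoeff P.K (tl m j) q - sineCoeff P.K (br m j) q) / P.tau)
            - P.Vinfq q * ((sineCoeff P.K (br m j) q + sineCoeff P.K (tl m j) q) / 2)) P.J
    = P.cq q * conv (P.R q) (fun n => sineCoeff P.K (tl n P.J) q) m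

/-- `Psi`, `br = Ψ̆`, `tl = Ψ̃` solve the splitting scheme on the finite space mesh with the free
term `F` and the initial function `Psi0`. The convolution in the boundary condition involves the
value of `Ψ̃` on the level `0`, which is that of the initial function. -/
structure IsSolution (F : ℕ → MeshFun) (Psi0 : MeshFun) (Psi br tl : ℕ → MeshFun) : Prop where
  step_one : ∀ m, 1 ≤ m → P.PotentialStep (Psi (m - 1)) (br m)
  step_two : ∀ m, 1 ≤ m → P.MainStep (br m) (tl m) (F m)
  step_three : ∀ m, 1 ≤ m → P.PotentialStep (tl m) (Psi m)
  boundary : ∀ m, 1 ≤ m → ∀ j k, P.dirichlet j k →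
    br m j k = 0 ∧ tl m j k = 0 ∧ Psi m j k = 0
  initial : ∀ j k, P.onMesh j k → Psi 0 j k = Psi0 j k
  initial_tilde : ∀ j k, P.onMesh j k → tl 0 j k = Psi0 j k
  tbc : ∀ m, 1 ≤ m → P.TBC br tl m

end Setup

end SplitNumerov

end

/-! Stability is an energy estimate on a half-strip; existence and uniqueness follow from it.

The sine transform in `y` turns the main step into independent one-dimensional steps for the
coefficients `q` (`MainStep.mainStepq`). For each `q`, the transparent condition says exactly that
the solution continues beyond `j = J` as a solution of the scheme with constant potential. In
generating functions over the time level, the continuation is multiplication by powers of a root `ν`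
of `P ν² + (E - 2P) ν + P = 0`. The kernel `R_q`, times `c_{ħ,q}/h_x`, is the square root of the
quarter discriminant `E²/4 - P E` (`discriminant`), so the boundary condition becomes the equation
of the scheme at `j = J` (`mainStepq_cont`). The branch of the argument selects the root whose
constant coefficient has modulus less than one (`norm_root_lt_one`), so that at each time level the
continuation is square summable in `j` (`summable_coeff_pow_mul`).

On the half-line the step is `S g = r (A + B) + G`, with `S` the self-adjoint invertible Numerov
average and `g = iκ(B - A) - v + r(A + B)`, where `v` is the real potential times `(A + B)/2`. With
`e = S⁻¹ G`, the number `⟨g - e, S (g - e)⟩ = r ⟨g - e, A + B⟩` is real. Its imaginary part gives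
`κ(‖B‖² - ‖A‖²) = -Im⟨e, A + B⟩`, whether or not `S` commutes with the potential
(`norm_le_of_step`).

The half-steps with `ΔV` are Cayley transforms: they preserve moduli at every node and act trivially
on the column `j = J`. Hence the energy, which is the sum of squares on the mesh plus the tail of
the continuation, passes from one time level to the next (`IsSolution.sqrt_energy_succ_le`). A
homogeneous step has only the zero solution, so the square linear system of each level is uniquely
solvable. -/

namespace SplitNumerov

open scoped InnerProductSpace PowerSeries

/-! ### Energy estimate for an averaged Crank–Nicolson step in a Hilbert space -/

section Hilbert

variable {E : Type*} [NormedAddCommGroup E] [InnerProductSpace ℂ E]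

/-- The average `(1 - 2θ) u + θ T u`. -/
noncomputable def avg (θ : ℝ) (T : E →L[ℂ] E) (u : E) : E := ((1 - 2 * θ : ℝ) : ℂ) • u + (θ : ℂ) • T u

theorem inner_avg_comm {T : E →L[ℂ] E} (hT : ∀ u v, ⟪T u, v⟫_ℂ = ⟪u, T v⟫_ℂ) (θ : ℝ) (u v : E) :
    ⟪avg θ T u, v⟫_ℂ = ⟪u, avg θ T v⟫_ℂ := by
  simp only [avg, inner_add_left, inner_add_right, inner_smul_left, inner_smul_right, hT,
    Complex.conj_ofReal]

theorem avg_sub (θ : ℝ) (T : E →L[ℂ] E) (u v : E) :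
    avg θ T (u - v) = avg θ T u - avg θ T v := by
  simp only [avg, map_sub, smul_sub]; abel

/-- Neumann series: the average is `(1 - 2θ)(1 - t)` with `‖t‖ ≤ 2θ/(1 - 2θ)`, and this is below one
exactly when `θ < 1/4`. The bound on the preimage is the triangle inequality. -/
theorem exists_avg_eq [CompleteSpace E] {T : E →L[ℂ] E} (hT2 : ‖T‖ ≤ 2) {θ : ℝ} (hθ0 : 0 < θ) (hθ : θ < 1 / 4)
    (G : E) : ∃ e, avg θ T e = G ∧ (1 - 4 * θ) * ‖e‖ ≤ ‖G‖ := by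
  have h1 : 0 < 1 - 2 * θ := by linarith
  set t : E →L[ℂ] E := (-((θ / (1 - 2 * θ) : ℝ) : ℂ)) • T with ht
  have hnt : ‖t‖ < 1 := by
    rw [ht, norm_smul, norm_neg, Complex.norm_real, Real.norm_of_nonneg (by positivity)]
    calc θ / (1 - 2 * θ) * ‖T‖ ≤ θ / (1 - 2 * θ) * 2 := by gcongr
      _ < 1 := by rw [div_mul_eq_mul_div, div_lt_one h1]; linarith
  obtain ⟨u, hu⟩ := isUnit_one_sub_of_norm_lt_one hnt
  have h2 : (↑u : E →L[ℂ] E) ((↑u⁻¹ : E →L[ℂ] E) G) = G := by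
    rw [← mul_apply_eq_comp, Units.mul_inv]; rfl
  have h3 : ((1 - 2 * θ : ℝ) : ℂ) ≠ 0 := by exact_mod_cast h1.ne'
  obtain ⟨e, he⟩ : ∃ e, avg θ T e = G := by
    refine ⟨((1 - 2 * θ : ℝ) : ℂ)⁻¹ • (↑u⁻¹ : E →L[ℂ] E) G, ?_⟩
    rw [hu] at h2
    set y := (↑u⁻¹ : E →L[ℂ] E) G
    have h4 : (1 - t) y = y - t y := rfl
    have h5 : t y = (-((θ / (1 - 2 * θ) : ℝ) : ℂ)) • T y := rfl
    rw [h4, h5, neg_smul, sub_neg_eq_add] at h2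
    rw [avg, map_smul, smul_smul, smul_smul, mul_inv_cancel₀ h3, one_smul, ← h2]
    push_cast
    rw [div_eq_mul_inv]
  refine ⟨e, he, ?_⟩
  have h4 : ((1 - 2 * θ : ℝ) : ℂ) • e = G - (θ : ℂ) • T e := by
      rw [← he, avg]; abel
  have h5 : (1 - 2 * θ) * ‖e‖ ≤ ‖G‖ + θ * (2 * ‖e‖) := by
    calc (1 - 2 * θ) * ‖e‖ = ‖((1 - 2 * θ : ℝ) : ℂ) • e‖ := by
          rw [norm_smul, Complex.norm_real, Real.norm_of_nonneg h1.le]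
      _ = ‖G - (θ : ℂ) • T e‖ := by rw [h4]
      _ ≤ ‖G‖ + ‖(θ : ℂ) • T e‖ := norm_sub_le _ _
      _ ≤ ‖G‖ + θ * (2 * ‖e‖) := by
          rw [norm_smul, Complex.norm_real, Real.norm_of_nonneg hθ0.le]
          gcongr
          exact (T.le_opNorm e).trans (by gcongr)
  linarith

/-- Stability of one Crank–Nicolson step with an averaging operator in front of the time
derivative and of the potential `v`, where the second difference is `(avg - 1)/θ`. -/
theorem norm_le_of_step [CompleteSpace E] {T : E →L[ℂ] E} (hT : ∀ u v, ⟪T u, v⟫_ℂ = ⟪u, T v⟫_ℂ) (hT2 : ‖T‖ ≤ 2)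
    {θ κ r : ℝ} (hθ0 : 0 < θ) (hθ : θ < 1 / 4) (hκ : 0 < κ) (hr : 0 < r) (A B v G : E)
    (hv : (⟪v, A + B⟫_ℂ).im = 0)
    (h : avg θ T ((Complex.I * κ) • (B - A) - v + (r : ℂ) • (A + B)) = (r : ℂ) • (A + B) + G) :
    ‖B‖ ≤ ‖A‖ + ‖G‖ / (κ * (1 - 4 * θ)) := by
  obtain ⟨e, he, hen⟩ := exists_avg_eq hT2 hθ0 hθ G
  have h4 : 0 < 1 - 4 * θ := by linarith
  set g := (Complex.I * κ) • (B - A) - v + (r : ℂ) • (A + B) with hg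
  have hf : avg θ T (g - e) = (r : ℂ) • (A + B) := by rw [avg_sub, h, he]; abel
  have h1 : (⟪g - e, A + B⟫_ℂ).im = 0 := by
    -- The quadratic form of a symmetric operator is real. Testing with `g - e` instead of `A + B`
    -- avoids any commutator of the average with the potential.
    have h2 : (⟪g - e, avg θ T (g - e)⟫_ℂ).im = 0 := by
      have := inner_avg_comm hT θ (g - e) (g - e)
      rw [← inner_conj_symm] at this
      exact Complex.conj_eq_iff_im.1 this
    rw [hf, inner_smul_right, Complex.im_ofReal_mul] at h2
    exact (mul_eq_zero.1 h2).resolve_left hr.ne'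
  have h3 : (⟪g, A + B⟫_ℂ).im = -(κ * (‖B‖ ^ 2 - ‖A‖ ^ 2)) := by
    have hre : (⟪B - A, A + B⟫_ℂ).re = ‖B‖ ^ 2 - ‖A‖ ^ 2 := by
      have e1 : (⟪B, B⟫_ℂ).re = ‖B‖ ^ 2 := (norm_sq_eq_re_inner (𝕜 := ℂ) B).symm
      have e2 : (⟪A, A⟫_ℂ).re = ‖A‖ ^ 2 := (norm_sq_eq_re_inner (𝕜 := ℂ) A).symm
      have e3 : (⟪A, B⟫_ℂ).re = (⟪B, A⟫_ℂ).re := by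
        rw [← inner_conj_symm, Complex.conj_re]
      simp only [inner_sub_left, inner_add_right, Complex.sub_re, Complex.add_re, e1, e2, e3]
      ring
    have him : (⟪A + B, A + B⟫_ℂ).im = 0 := inner_self_im (𝕜 := ℂ) (A + B)
    rw [hg, inner_add_left, inner_sub_left, inner_smul_left, inner_smul_left]
    rw [Complex.add_im, Complex.sub_im, hv, Complex.conj_ofReal, Complex.im_ofReal_mul, him]
    simp [hre]
  have h5 : κ * (‖B‖ ^ 2 - ‖A‖ ^ 2) = -(⟪e, A + B⟫_ℂ).im := by
    rw [inner_sub_left, Complex.sub_im, h3] at h1; linarith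
  have h6 : κ * (‖B‖ ^ 2 - ‖A‖ ^ 2) ≤ ‖e‖ * (‖A‖ + ‖B‖) := by
    rw [h5]
    calc -(⟪e, A + B⟫_ℂ).im ≤ |(⟪e, A + B⟫_ℂ).im| := neg_le_abs _
      _ ≤ ‖⟪e, A + B⟫_ℂ‖ := Complex.abs_im_le_norm _
      _ ≤ ‖e‖ * ‖A + B‖ := norm_inner_le_norm _ _
      _ ≤ ‖e‖ * (‖A‖ + ‖B‖) := by gcongr; exact norm_add_le _ _
  have h7 : κ * (‖B‖ - ‖A‖) ≤ ‖e‖ := by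
    -- The common factor `‖A‖ + ‖B‖` is cancelled; if it is zero, both norms vanish.
    rcases (add_nonneg (norm_nonneg A) (norm_nonneg B)).eq_or_lt with h0 | h0
    · have := norm_nonneg A; have := norm_nonneg B
      rw [show ‖B‖ - ‖A‖ = 0 by linarith, mul_zero]; exact norm_nonneg e
    · refine le_of_mul_le_mul_right ?_ h0
      linarith
  have h8 : κ * (1 - 4 * θ) * (‖B‖ - ‖A‖) ≤ ‖G‖ := by
    nlinarith
  rw [← sub_le_iff_le_add', le_div_iff₀ (by positivity)]
  linarith

end Hilbert

/-! ### The sum of the two shifts on `ℓ²` -/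

/-- Square summable sequences. -/
noncomputable abbrev Seq2 := lp (fun _ : ℕ => ℂ) 2

theorem memlp_two_iff {f : ℕ → ℂ} : Memℓp f 2 ↔ Summable fun i => ‖f i‖ ^ 2 := by
  rw [memℓp_gen_iff (by norm_num)]; simp

theorem seq2_norm_sq (f : Seq2) : ‖f‖ ^ 2 = ∑' i, ‖f i‖ ^ 2 := by
  have := lp.norm_rpow_eq_tsum (p := 2) (by norm_num) f
  simpa using this

/-- The left shift on `ℓ²`. -/
noncomputable def leftShift : Seq2 →L[ℂ] Seq2 :=
  LinearMap.mkContinuous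
    { toFun := fun f => ⟨fun i => f (i + 1),
        memlp_two_iff.2 ((summable_nat_add_iff 1).2 (memlp_two_iff.1 f.2))⟩
      map_add' := fun _ _ => rfl
      map_smul' := fun _ _ => rfl } 1 (by
    intro f
    rw [one_mul]
    refine le_of_sq_le_sq ?_ (norm_nonneg _)
    rw [seq2_norm_sq, seq2_norm_sq, (memlp_two_iff.1 f.2).tsum_eq_zero_add]
    exact le_add_of_nonneg_left (by positivity))

theorem leftShift_apply (f : Seq2) (i : ℕ) : leftShift f i = f (i + 1) := rfl

theorem norm_leftShift_le : ‖leftShift‖ ≤ 1 := LinearMap.mkContinuous_norm_le _ zero_le_one _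

theorem adjoint_leftShift_apply (f : Seq2) (i : ℕ) :
    ContinuousLinearMap.adjoint leftShift f i = if i = 0 then 0 else f (i - 1) := by
  have h1 : ContinuousLinearMap.adjoint leftShift f i
      = ⟪leftShift (lp.single 2 i (1 : ℂ)), f⟫_ℂ := by
    rw [← ContinuousLinearMap.adjoint_inner_right, lp.inner_single_left]
    simp
  rw [h1]
  rcases i with _ | i
  · have : leftShift (lp.single 2 0 (1 : ℂ)) = 0 := by
      ext j
      rw [leftShift_apply]
      simp
    rw [this]; simp
  · have : leftShift (lp.single 2 (i + 1) (1 : ℂ)) = lp.single 2 i (1 : ℂ) := by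
      ext j
      rw [leftShift_apply]
      simp [Pi.single_apply]
    rw [this, lp.inner_single_left]; simp

/-- The operator `u ↦ (u_{i-1} + u_{i+1})_i` with `u_{-1} = 0`. -/
noncomputable def neighbourSum : Seq2 →L[ℂ] Seq2 := leftShift + ContinuousLinearMap.adjoint leftShift

theorem neighbourSum_apply (f : Seq2) (i : ℕ) :
    neighbourSum f i = f (i + 1) + if i = 0 then 0 else f (i - 1) := by
  rw [← adjoint_leftShift_apply, ← leftShift_apply]; rfl

theorem norm_neighbourSum_le : ‖neighbourSum‖ ≤ 2 := by
  refine (norm_add_le _ _).trans ?_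
  rw [LinearIsometryEquiv.norm_map]
  linarith [norm_leftShift_le]

theorem inner_neighbourSum (u v : Seq2) : ⟪neighbourSum u, v⟫_ℂ = ⟪u, neighbourSum v⟫_ℂ := by
  simp only [neighbourSum, add_apply, inner_add_left, inner_add_right,
    ContinuousLinearMap.adjoint_inner_left, ContinuousLinearMap.adjoint_inner_right]
  rw [add_comm]

/-! ### Formal power series -/

/-- Summing the recurrence gives `(1 - r) ∑ a ≤ a 0 + ∑ b` for every partial sum; a negative `r` may
be replaced by zero. -/
theorem summable_of_le_mul_add {a b : ℕ → ℝ} {r : ℝ} (ha : ∀ i, 0 ≤ a i) (hb0 : ∀ i, 0 ≤ b i)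
    (hb : Summable b) (hr : r < 1) (h : ∀ i, a (i + 1) ≤ r * a i + b i) : Summable a := by
  wlog hr0 : 0 ≤ r generalizing r
  · exact this zero_lt_one
      (fun i => (h i).trans (by have := ha i; nlinarith)) le_rfl
  refine summable_of_sum_range_le (c := (a 0 + ∑' i, b i) / (1 - r)) ha fun n => ?_
  rw [le_div_iff₀ (by linarith)]
  have h1 : ∑ i ∈ Finset.range n, a i ≤ ∑ i ∈ Finset.range (n + 1), a i := by
    rw [Finset.sum_range_succ]; linarith [ha n]
  have h2 : ∑ i ∈ Finset.range n, a (i + 1)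
      ≤ r * ∑ i ∈ Finset.range n, a i + ∑ i ∈ Finset.range n, b i := by
    rw [Finset.mul_sum, ← Finset.sum_add_distrib]
    exact Finset.sum_le_sum fun i _ => h i
  have h3 : ∑ i ∈ Finset.range n, b i ≤ ∑' i, b i := hb.sum_le_tsum _ fun i _ => hb0 i
  rw [Finset.sum_range_succ'] at h1
  linarith

/-- Write `ν = ν₀ + X ν'`. The coefficient `m` of `ν^(i+1) f` is `ν₀` times that of `ν^i f`, plus
the coefficient `m - 1` of `ν^i (ν' f)`, summable by induction. The change from `f` to `ν' f` is why
the induction runs over all `f`. -/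
theorem summable_coeff_pow_mul {ν : ℂ⟦X⟧} (hν : ‖PowerSeries.constantCoeff ν‖ < 1) (m : ℕ) :
    ∀ f : ℂ⟦X⟧, Summable fun i => ‖PowerSeries.coeff m (ν ^ i * f)‖ := by
  set ν' : ℂ⟦X⟧ := PowerSeries.mk fun n => PowerSeries.coeff (n + 1) ν
  have hdec : ν = PowerSeries.X * ν' + PowerSeries.C (PowerSeries.constantCoeff ν) :=
    PowerSeries.eq_X_mul_shift_add_const ν
  have hstep : ∀ (f : ℂ⟦X⟧) (i : ℕ), ν ^ (i + 1) * f
      = PowerSeries.C (PowerSeries.constantCoeff ν) * (ν ^ i * f)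
        + PowerSeries.X * (ν ^ i * (ν' * f)) := by
    intro f i
    conv_lhs => rw [pow_succ', hdec]
    conv_lhs => enter [1, 2, 1]; rw [← hdec]
    ring
  induction m with
  | zero =>
    intro f
    refine summable_of_le_mul_add (b := fun _ => 0) (fun _ => norm_nonneg _) (fun _ => le_rfl)
      summable_zero hν fun i => ?_
    rw [hstep]
    simp
  | succ m ih =>
    intro f
    refine summable_of_le_mul_add (fun _ => norm_nonneg _) (fun _ => norm_nonneg _)
      (ih (ν' * f)) hν fun i => ?_
    rw [hstep, map_add, PowerSeries.coeff_C_mul, PowerSeries.coeff_succ_X_mul]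
    refine (norm_add_le _ _).trans ?_
    rw [norm_mul]

theorem summable_sq_coeff_pow_mul {ν : ℂ⟦X⟧} (hν : ‖PowerSeries.constantCoeff ν‖ < 1) (m : ℕ)
    (f : ℂ⟦X⟧) : Summable fun i => ‖PowerSeries.coeff m (ν ^ i * f)‖ ^ 2 := by
  have h := summable_coeff_pow_mul hν m f
  have h1 : Memℓp (fun i => PowerSeries.coeff m (ν ^ i * f)) 1 := by
    rw [memℓp_gen_iff (by norm_num)]; simpa using h
  exact memlp_two_iff.1 (h1.of_exponent_ge (by norm_num))

open PowerSeries in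
/-- The generating function of the kernel is `c √(1 - 2 x z + y z²)`. -/
theorem sq_mk_of_recurrence {R : ℕ → ℂ} {x y c : ℂ} (h0 : R 0 = c) (h1 : R 1 = -c * x)
    (hrec : ∀ n : ℕ, R (n + 2) = (2 * ((n : ℂ) + 2) - 3) / ((n : ℂ) + 2) * x * R (n + 1)
        - (((n : ℂ) + 2) - 3) / ((n : ℂ) + 2) * y * R n) :
    (mk R) ^ 2 = C (c ^ 2) * (1 - C (2 * x) * X + C y * X ^ 2) := by
  set G : ℂ⟦X⟧ := mk R with hG
  set Q : ℂ⟦X⟧ := 1 - C (2 * x) * X + C y * X ^ 2 with hQ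
  have hQ' : d⁄dX ℂ Q = C (2 : ℂ) * (-C x + C y * X) := by
    simp only [hQ, map_add, map_sub, Derivation.leibniz, derivative_C, derivative_X,
      Derivation.leibniz_pow, derivative_one, map_mul, smul_eq_mul]
    have h2 : (C (2 : ℂ) : ℂ⟦X⟧) = 2 := map_ofNat _ 2
    simp [h2]
    ring
  -- The recurrence is the coefficientwise form of `Q G' = (Q'/2) G`; the two initial values give
  -- its lowest coefficient.
  have hode : Q * d⁄dX ℂ G = (-C x + C y * X) * G := by
    ext n
    have e1 : Q * d⁄dX ℂ G = d⁄dX ℂ G - C (2 * x) * (X * d⁄dX ℂ G)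
        + C y * (X * (X * d⁄dX ℂ G)) := by rw [hQ]; ring
    have e2 : (-C x + C y * X) * G = C (-x) * G + C y * (X * G) := by
      rw [map_neg]; ring
    rw [e1, e2]
    rcases n with _ | _ | n
    · simp only [map_add, map_sub, coeff_C_mul, coeff_zero_X_mul, coeff_derivative, hG, coeff_mk]
      simp [h0, h1]; ring
    · simp only [map_add, map_sub, coeff_C_mul, coeff_succ_X_mul, coeff_zero_X_mul,
        coeff_derivative, hG, coeff_mk]
      have := hrec 0
      simp only [Nat.cast_zero, zero_add] at this
      norm_num at this ⊢
      rw [this]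
      ring
    · simp only [map_add, map_sub, coeff_C_mul, coeff_succ_X_mul, coeff_derivative, hG, coeff_mk]
      have := hrec (n + 1)
      have hne : (n : ℂ) + 1 + 2 ≠ 0 := by exact_mod_cast (by omega : n + 1 + 2 ≠ 0)
      rw [show n + 1 + 1 + 1 = n + 1 + 2 from rfl, this]
      push_cast
      field_simp
      ring
  have hc : constantCoeff Q = 1 := by simp [hQ]
  have hQQ : Q * Q⁻¹ = 1 := PowerSeries.mul_inv_cancel _ (by simp [hc])
  -- The differential equation makes the derivative of `G²/Q` vanish, so this quotient equals its
  -- constant coefficient.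
  have hd : G ^ 2 * Q⁻¹ = C (c ^ 2) := by
    refine derivative.ext ?_ ?_
    · rw [derivative_C, Derivation.leibniz, Derivation.leibniz_pow, derivative_inv', hQ']
      simp only [smul_eq_mul, nsmul_eq_mul]
      have : G * d⁄dX ℂ G = Q⁻¹ * (-C x + C y * X) * G ^ 2 := by
        have : Q⁻¹ * (Q * d⁄dX ℂ G) * G = Q⁻¹ * ((-C x + C y * X) * G) * G := by rw [hode]
        linear_combination this - G * d⁄dX ℂ G * hQQ
      have h2 : (C (2 : ℂ) : ℂ⟦X⟧) = 2 := map_ofNat _ 2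
      rw [h2]
      push_cast
      linear_combination 2 * Q⁻¹ * this
    · have : constantCoeff G = c := by simp [hG, h0]
      simp [hc, this]
  calc G ^ 2 = G ^ 2 * Q⁻¹ * Q := by rw [mul_assoc, mul_comm Q⁻¹, hQQ, mul_one]
    _ = _ := by rw [hd]

/-- Location of the root of the characteristic equation that is selected by the branch of the
square root with nonnegative imaginary part. -/
theorem norm_root_lt_one {θ D : ℝ} {E p ρ ν : ℂ} (hθ0 : 0 < θ) (hθ : θ < 1 / 4) (hD : 0 < D)
    (hE : 0 < E.im) (hp : p = θ * E + D) (hρ : 0 ≤ ρ.im) (h1 : p * ν = p - E / 2 + ρ)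
    (h2 : ρ ^ 2 = E ^ 2 / 4 - p * E) : ‖ν‖ < 1 := by
  have hp0 : p ≠ 0 := by
    intro h
    have := congrArg Complex.im (hp.symm.trans h)
    simp at this
    rcases this with h | h <;> linarith
  have hchar : p * (ν ^ 2 + 1) = (2 * p - E) * ν := by
    have : p * (p * (ν ^ 2 + 1) - (2 * p - E) * ν) = 0 := by
      have e : p * ν + E / 2 - p = ρ := by rw [h1]; ring
      have : (p * ν + E / 2 - p) ^ 2 = E ^ 2 / 4 - p * E := by rw [e, h2]
      linear_combination this
    exact sub_eq_zero.1 ((mul_eq_zero.1 this).resolve_left hp0)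
  have hν0 : ν ≠ 0 := by
    rintro rfl
    simp at hchar
    exact hp0 hchar
  -- `M` is the symbol of the average, up to the factor `ν`. It satisfies `p M = D ν`, which
  -- expresses both `ρ` and `E` through `ν` alone.
  set M : ℂ := (1 - 2 * θ) * ν + θ * (ν ^ 2 + 1) with hM
  have hpM : p * M = D * ν := by
    rw [hM]
    have : p * ((1 - 2 * θ) * ν + θ * (ν ^ 2 + 1))
      = (1 - 2 * θ) * ν * p + θ * (p * (ν ^ 2 + 1)) := by ring
    rw [this, hchar]
    linear_combination ν * hp
  have hρM : 2 * ρ * M = D * (ν ^ 2 - 1) := by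
    have e1 : 2 * ρ * ν = p * (ν ^ 2 - 1) := by linear_combination (-2 * ν) * h1 + hchar
    refine mul_left_cancel₀ hν0 ?_
    linear_combination M * e1 + (ν ^ 2 - 1) * hpM
  have hEM : E * M = -(D * (ν - 1) ^ 2) := by
    have e1 : E * ν = -(p * (ν - 1) ^ 2) := by linear_combination hchar
    refine mul_left_cancel₀ hν0 ?_
    linear_combination M * e1 - (ν - 1) ^ 2 * hpM
  have hM0 : M ≠ 0 := by
    intro h
    rw [h, mul_zero] at hpM
    exact (mul_ne_zero (by exact_mod_cast hD.ne') hν0) hpM.symm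
  have hMpos : 0 < Complex.normSq M := Complex.normSq_pos.2 hM0
  set x := ν.re
  set y := ν.im
  have hMre : M.re = (1 - 2 * θ) * x + θ * (x ^ 2 - y ^ 2 + 1) := by
    simp [hM, x, y, pow_two]
  have hMim : M.im = (1 - 2 * θ) * y + θ * (2 * x * y) := by
    simp only [hM, x, y, pow_two, Complex.add_im, Complex.mul_im, Complex.sub_im, Complex.sub_re,
      Complex.mul_re, Complex.add_re, Complex.ofReal_im, Complex.ofReal_re, Complex.one_im,
      Complex.one_re, Complex.re_ofNat, Complex.im_ofNat]
    ring
  -- Multiplying by the conjugate of `M` and taking imaginary parts isolates two signs: that of `Im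
  -- ρ` forces `y ≥ 0`, and that of `Im E` forces `y (1 - |ν|²) > 0`.
  have hA : 2 * ρ.im * Complex.normSq M
      = D * (y * ((1 - 2 * θ) * (x ^ 2 + y ^ 2 + 1) + 4 * θ * x)) := by
    have := congrArg (fun z => (z * (starRingEnd ℂ) M).im) hρM
    simp only [mul_assoc, Complex.mul_conj] at this
    simp [pow_two] at this
    rw [hMre, hMim] at this
    linear_combination this
  have hB : E.im * Complex.normSq M = D * (y * (1 - (x ^ 2 + y ^ 2))) := by
    have := congrArg (fun z => (z * (starRingEnd ℂ) M).im) hEM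
    simp only [mul_assoc, Complex.mul_conj] at this
    simp [pow_two] at this
    rw [hMre, hMim] at this
    linear_combination this
  -- The bracket equals `(1 - 4θ)(x² + y² + 1) + 2θ((x + 1)² + y²)`.
  have hbr : 0 < (1 - 2 * θ) * (x ^ 2 + y ^ 2 + 1) + 4 * θ * x := by
    nlinarith [mul_nonneg hθ0.le (sq_nonneg (x + 1)), sq_nonneg x, sq_nonneg y,
      mul_nonneg (sub_nonneg.2 hθ.le) (add_nonneg (sq_nonneg x) (sq_nonneg y))]
  have hyn : 0 < y * (1 - (x ^ 2 + y ^ 2)) :=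
    pos_of_mul_pos_right (hB ▸ mul_pos hE hMpos) hD.le
  have hy : 0 ≤ y := by
    have h3 : 0 ≤ D * (y * ((1 - 2 * θ) * (x ^ 2 + y ^ 2 + 1) + 4 * θ * x)) :=
      hA ▸ mul_nonneg (by linarith) hMpos.le
    exact nonneg_of_mul_nonneg_left (nonneg_of_mul_nonneg_right h3 hD) hbr
  have hn : x ^ 2 + y ^ 2 < 1 := by
    by_contra hcon
    push Not at hcon
    nlinarith
  rw [← sq_lt_one_iff₀ (norm_nonneg _), Complex.sq_norm, Complex.normSq_apply]
  nlinarith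

/-! ### Bounds on the coefficients of the scheme -/

namespace Setup

variable (P : Setup)

theorem X_pos : 0 < P.X := P.X0_pos.trans P.X0_lt_X

theorem two_le_J : 2 ≤ P.J := by
  by_contra h
  have h1 : P.J = 1 := by have := P.J_pos; omega
  have h2 := P.hx_le
  rw [h1] at h2
  have := P.X0_pos
  simp at h2
  linarith

theorem hx_pos : 0 < P.hx := div_pos P.X_pos (Nat.cast_pos.2 P.J_pos)

theorem hy_pos : 0 < P.hy := div_pos P.Y_pos (Nat.cast_pos.2 P.K_pos)

theorem c_pos : 0 < P.c := div_pos (pow_pos P.hbar_pos 2) (mul_pos two_pos P.m0_pos)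

theorem X0_le_node {j : ℕ} (hj : P.J - 1 ≤ j) : P.X0 ≤ j * P.hx := by
  have h1 : (P.J : ℝ) - 1 ≤ j := by
    have : P.J ≤ j + 1 := by omega
    have : (P.J : ℝ) ≤ j + 1 := by exact_mod_cast this
    linarith
  have h2 : (P.J : ℝ) * P.hx = P.X :=
    mul_div_cancel₀ _ (Nat.cast_pos.2 P.J_pos).ne'
  have h3 : P.hx ≤ P.X - P.X0 := P.hx_le
  nlinarith [P.hx_pos]

theorem VtMesh_far {j : ℕ} (hj : P.J - 1 ≤ j) : P.VtMesh j = P.Vinf :=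
  P.Vt_far _ (P.X0_le_node hj)

/-- All but finitely many nodes of the half-line lie where the potential is constant. Boundedness
keeps the potential term in `ℓ²`. -/
theorem exists_abs_VtMesh_le : ∃ C, ∀ j, |P.VtMesh j| ≤ C := by
  refine ⟨|P.Vinf| + ∑ j ∈ Finset.range P.J, |P.VtMesh j|, fun j => ?_⟩
  by_cases hj : j < P.J
  · have := Finset.single_le_sum (f := fun j => |P.VtMesh j|) (fun _ _ => abs_nonneg _)
      (Finset.mem_range.2 hj)
    linarith [abs_nonneg P.Vinf]
  · rw [P.VtMesh_far (by omega)]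
    exact le_add_of_nonneg_right (Finset.sum_nonneg fun _ _ => abs_nonneg _)

variable (q : ℕ)

theorem sig_eq : P.sig q = 1 - Real.sin (Real.pi * q * P.hy / (2 * P.Y)) ^ 2 / 3 := by
  have := P.hy_pos.ne'
  rw [sig, lam]
  field_simp
  ring

theorem sig_ge : 2 / 3 ≤ P.sig q := by
  rw [sig_eq]
  linarith [Real.sin_sq_le_one (Real.pi * q * P.hy / (2 * P.Y))]

theorem sig_pos : 0 < P.sig q := by linarith [P.sig_ge q]

theorem theta_pos : 0 < P.theta q := by
  have := P.sig_pos q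
  rw [theta]; positivity

theorem theta_mul_sig : P.theta q * P.sig q = 1 / 12 := by
  have := (P.sig_pos q).ne'
  rw [theta]; field_simp

theorem theta_lt : P.theta q < 1 / 4 := by
  nlinarith [P.theta_mul_sig q, P.sig_ge q, P.theta_pos q]

/-- Since `θ_q σ_q = 1/12`, the right-hand side is `σ_q - 1/3`. This is the source of the factor 3
in the stability estimate. -/
theorem one_third_le : 1 / 3 ≤ P.sig q * (1 - 4 * P.theta q) := by
  nlinarith [P.theta_mul_sig q, P.sig_ge q]

theorem cq_pos : 0 < P.cq q := mul_pos P.c_pos (by positivity)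

/-! ### The characteristic equation and the kernel -/

/-- Constant coefficient of `charE`. -/
noncomputable def e0 : ℂ := Complex.I * (P.hbar / P.tau : ℝ) - (P.Vinfq q / 2 : ℝ)

/-- Linear coefficient of `charE`. -/
noncomputable def e1 : ℂ := -Complex.I * (P.hbar / P.tau : ℝ) - (P.Vinfq q / 2 : ℝ)

/-- `c_{ħ,q} / (2 h_x²)`. -/
noncomputable def dq : ℝ := P.cq q / (2 * P.hx ^ 2)

/-- The symbol of `iħ ∂̄_t - V_{∞,q} s̄_t`. -/
noncomputable def charE : ℂ⟦X⟧ := PowerSeries.C (P.e0 q) + PowerSeries.C (P.e1 q) * PowerSeries.X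

/-- The coefficient of `u_{j-1} + u_{j+1}` in the scheme with constant coefficients. -/
noncomputable def charP : ℂ⟦X⟧ :=
  PowerSeries.C (P.theta q * P.e0 q + P.dq q : ℂ)
    + PowerSeries.C (P.theta q * P.e1 q + P.dq q : ℂ) * PowerSeries.X

theorem dq_pos : 0 < P.dq q := div_pos (P.cq_pos q) (by have := P.hx_pos; positivity)

theorem e0_im : (P.e0 q).im = P.hbar / P.tau := by simp [e0, -Complex.ofReal_div]

theorem e0_im_pos : 0 < (P.e0 q).im := by rw [e0_im]; exact div_pos P.hbar_pos P.tau_pos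

theorem aq_im_pos : 0 < (P.aq q).im := by
  have : (P.aq q).im = P.hbar / (P.tau * P.cq q) := by
    rw [aq, Complex.add_im, Complex.ofReal_im, Complex.I_mul_im, Complex.ofReal_re, zero_add]
  rw [this]
  exact div_pos P.hbar_pos (mul_pos P.tau_pos (P.cq_pos q))

/-- Both factors of `α = a (2 + (1 - 4θ) h_x² a)` have positive imaginary part, because `Im a > 0`
and `θ < 1/4`. -/
theorem alphaq_ne_zero : P.alphaq q ≠ 0 := by
  have ha := P.aq_im_pos q
  have h1 : P.alphaq q
      = P.aq q * (2 + (((1 - 4 * P.theta q) * P.hx ^ 2 : ℝ) : ℂ) * P.aq q) := by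
    rw [alphaq]; push_cast; ring
  rw [h1]
  refine mul_ne_zero (fun h => by rw [h] at ha; simp at ha) fun h => ?_
  have := congrArg Complex.im h
  rw [Complex.add_im, Complex.im_ofReal_mul] at this
  have h4 : 0 < (1 - 4 * P.theta q) * P.hx ^ 2 :=
    mul_pos (by linarith [P.theta_lt q]) (pow_pos P.hx_pos 2)
  simp only [Complex.im_ofNat, zero_add, Complex.zero_im] at this
  exact (mul_pos h4 ha).ne' this

theorem exp_argPos (z : ℂ) : (‖z‖ : ℂ) * Complex.exp (Complex.I * argPos z) = z := by
  have h : Complex.exp (Complex.I * argPos z) = Complex.exp (z.arg * Complex.I) := by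
    rw [argPos]
    split_ifs
    · rw [mul_comm]
    · push_cast
      rw [mul_add, Complex.exp_add, show Complex.I * (2 * Real.pi) = 2 * Real.pi * Complex.I by ring,
        Complex.exp_two_pi_mul_I, mul_one, mul_comm]
  rw [h, Complex.norm_mul_exp_arg_mul_I]

theorem exp_neg_argPos (z : ℂ) :
    (‖z‖ : ℂ) * Complex.exp (-(Complex.I * argPos z)) = (starRingEnd ℂ) z := by
  conv_rhs => rw [← exp_argPos z]
  rw [map_mul, Complex.conj_ofReal, ← Complex.exp_conj, map_mul, Complex.conj_I,
    Complex.conj_ofReal, neg_mul]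

theorem argPos_mem (z : ℂ) : 0 ≤ argPos z ∧ argPos z ≤ 2 * Real.pi := by
  have h1 := Complex.neg_pi_lt_arg z
  have h2 := Complex.arg_le_pi z
  have := Real.pi_pos
  rw [argPos]
  split_ifs with h <;> constructor <;> linarith

theorem c1q_sq : P.c1q q ^ 2 = (starRingEnd ℂ) (P.alphaq q) / 4 := by
  rw [c1q, mul_pow, neg_sq, ← Complex.exp_nat_mul, ← exp_neg_argPos, ← Complex.ofReal_pow, div_pow,
    Real.sq_sqrt (norm_nonneg _)]
  push_cast
  rw [show (2 : ℂ) * (-Complex.I * argPos (P.alphaq q) / 2)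
    = -(Complex.I * argPos (P.alphaq q)) by ring]
  ring

/-- Half of an argument in `[0, 2π]` has nonnegative sine; the minus sign in front of `c_{1q}`
cancels that of the exponent. This is where the choice of branch enters. -/
theorem c1q_im_nonneg : 0 ≤ (P.c1q q).im := by
  have h := argPos_mem (P.alphaq q)
  have h1 : 0 ≤ Real.sin (argPos (P.alphaq q) / 2) :=
    Real.sin_nonneg_of_nonneg_of_le_pi (by linarith) (by linarith)
  have h2 : (P.c1q q).im
      = Real.sqrt ‖P.alphaq q‖ / 2 * Real.sin (argPos (P.alphaq q) / 2) := by
    rw [c1q, ← Complex.ofReal_neg, Complex.im_ofReal_mul,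
      show -Complex.I * (argPos (P.alphaq q) : ℂ) / 2
        = ((-(argPos (P.alphaq q) / 2) : ℝ) : ℂ) * Complex.I by push_cast; ring,
      Complex.exp_ofReal_mul_I_im, Real.sin_neg]
    ring
  rw [h2]
  positivity

/-- The square of the generating function of the kernel. -/
theorem mk_R_sq : (PowerSeries.mk (P.R q)) ^ 2 = PowerSeries.C ((starRingEnd ℂ) (P.alphaq q) / 4)
    + PowerSeries.C (P.betaq q / 2 : ℂ) * PowerSeries.X
    + PowerSeries.C (P.alphaq q / 4) * PowerSeries.X ^ 2 := by
  have h := sq_mk_of_recurrence (R := P.R q) (x := P.kappaq q * P.muq q) (y := P.kappaq q ^ 2)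
    (c := P.c1q q) (by simp [R]) (by simp [R, mul_assoc]) (fun n => by rw [R]; ring)
  have hn : (‖P.alphaq q‖ : ℂ) ≠ 0 := by
    exact_mod_cast norm_ne_zero_iff.2 (P.alphaq_ne_zero q)
  have hE := exp_argPos (P.alphaq q)
  have hE' := exp_neg_argPos (P.alphaq q)
  have hcc : P.alphaq q * (starRingEnd ℂ) (P.alphaq q) = (‖P.alphaq q‖ : ℂ) ^ 2 :=
    Complex.mul_conj' _
  have hkap : P.kappaq q = -(P.alphaq q / ‖P.alphaq q‖) := by
    rw [kappaq, neg_inj, eq_div_iff hn, mul_comm]; exact hE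
  -- Since `c_{1q}²` is a quarter of the conjugate of `α`, and `ϰ = -α/|α|`, the coefficients of the
  -- quadratic polynomial reduce to `β/2` and `α/4`.
  have h1 : (starRingEnd ℂ) (P.alphaq q) / 4 * (2 * (P.kappaq q * P.muq q))
      = -(P.betaq q / 2 : ℂ) := by
    rw [hkap, muq]
    push_cast
    field_simp
    linear_combination (-4 : ℂ) * (P.betaq q : ℂ) * hcc
  have h2 : (starRingEnd ℂ) (P.alphaq q) / 4 * P.kappaq q ^ 2 = P.alphaq q / 4 := by
    rw [hkap]
    field_simp
    linear_combination P.alphaq q * hcc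
  have h1' := congrArg PowerSeries.C h1
  have h2' := congrArg PowerSeries.C h2
  rw [map_mul PowerSeries.C] at h1' h2'
  rw [map_neg] at h1'
  rw [h, c1q_sq]
  linear_combination -PowerSeries.X * h1' + PowerSeries.X ^ 2 * h2'

theorem e0_eq : P.e0 q = -(P.cq q * (starRingEnd ℂ) (P.aq q)) := by
  have h1 := P.tau_pos.ne'
  have h2 := (P.cq_pos q).ne'
  rw [e0, aq]
  simp only [map_add, map_mul, Complex.conj_ofReal, Complex.conj_I]
  push_cast
  have : (P.tau : ℂ) ≠ 0 := by exact_mod_cast h1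
  have : (P.cq q : ℂ) ≠ 0 := by exact_mod_cast h2
  field_simp
  ring

theorem e1_eq : P.e1 q = -(P.cq q * P.aq q) := by
  have h1 := P.tau_pos.ne'
  have h2 := (P.cq_pos q).ne'
  rw [e1, aq]
  push_cast
  have : (P.tau : ℂ) ≠ 0 := by exact_mod_cast h1
  have : (P.cq q : ℂ) ≠ 0 := by exact_mod_cast h2
  field_simp
  ring

/-- Both sides are quadratic in the time variable. After `e0 = -c_q ā` and `e1 = -c_q a`, their
three coefficients are the definitions of `ᾱ`, `β` and `α`. -/
theorem discriminant :
    (PowerSeries.C (P.cq q / P.hx : ℂ) * PowerSeries.mk (P.R q)) ^ 2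
      = PowerSeries.C (1 / 4 : ℂ) * P.charE q ^ 2 - P.charP q * P.charE q := by
  have hh : (P.hx : ℂ) ≠ 0 := by exact_mod_cast P.hx_pos.ne'
  have hc : (P.cq q : ℂ) ≠ 0 := by exact_mod_cast (P.cq_pos q).ne'
  have hnorm : P.aq q * (starRingEnd ℂ) (P.aq q) = (‖P.aq q‖ : ℂ) ^ 2 := Complex.mul_conj' _
  have hre : P.aq q + (starRingEnd ℂ) (P.aq q) = ((2 * (P.aq q).re : ℝ) : ℂ) := Complex.add_conj _
  push_cast at hre
  have hdq : (P.dq q : ℂ) = P.cq q / (2 * P.hx ^ 2) := by rw [dq]; push_cast; rfl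
  have h0 : (P.cq q / P.hx : ℂ) ^ 2 * ((starRingEnd ℂ) (P.alphaq q) / 4)
      = 1 / 4 * P.e0 q ^ 2 - (P.theta q * P.e0 q + P.dq q) * P.e0 q := by
    rw [alphaq, e0_eq, hdq]
    simp only [map_add, map_mul, map_sub, map_pow, Complex.conj_ofReal, map_one, map_ofNat]
    field_simp
    ring
  have h1 : (P.cq q / P.hx : ℂ) ^ 2 * (P.betaq q / 2)
      = 1 / 4 * (2 * P.e0 q * P.e1 q) - ((P.theta q * P.e0 q + P.dq q) * P.e1 q
        + (P.theta q * P.e1 q + P.dq q) * P.e0 q) := by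
    rw [betaq, e0_eq, e1_eq, hdq]
    push_cast
    rw [← hre, ← hnorm]
    field_simp
    ring
  have h2 : (P.cq q / P.hx : ℂ) ^ 2 * (P.alphaq q / 4)
      = 1 / 4 * P.e1 q ^ 2 - (P.theta q * P.e1 q + P.dq q) * P.e1 q := by
    rw [alphaq, e1_eq, hdq]
    field_simp
    ring
  rw [mul_pow, mk_R_sq, mul_add, mul_add, ← map_pow, ← mul_assoc, ← mul_assoc, ← map_mul,
    ← map_mul, ← map_mul, h0, h1, h2, charE, charP]
  simp only [map_add, map_mul, map_sub, map_pow, map_ofNat]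
  ring

/-- The decaying root of the characteristic equation as a formal power series in the time
variable. -/
noncomputable def nu : ℂ⟦X⟧ :=
  (P.charP q - PowerSeries.C (1 / 2 : ℂ) * P.charE q
    + PowerSeries.C (P.cq q / P.hx : ℂ) * PowerSeries.mk (P.R q)) * (P.charP q)⁻¹

theorem constantCoeff_charE : PowerSeries.constantCoeff (P.charE q) = P.e0 q := by
  simp [charE]

theorem constantCoeff_charP :
    PowerSeries.constantCoeff (P.charP q) = P.theta q * P.e0 q + P.dq q := by
  simp [charP]

theorem constantCoeff_charP_ne_zero : PowerSeries.constantCoeff (P.charP q) ≠ 0 := by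
  rw [constantCoeff_charP]
  intro h
  have := congrArg Complex.im h
  rw [Complex.add_im, Complex.im_ofReal_mul, Complex.ofReal_im, add_zero, Complex.zero_im] at this
  exact (mul_pos (P.theta_pos q) (P.e0_im_pos q)).ne' this

/-- Applied to the series of boundary values, this identity becomes the equation of the scheme at `j
= J` once the boundary condition is inserted. -/
theorem charP_mul_nu : P.charP q * P.nu q = P.charP q - PowerSeries.C (1 / 2 : ℂ) * P.charE q
    + PowerSeries.C (P.cq q / P.hx : ℂ) * PowerSeries.mk (P.R q) := by
  rw [nu, mul_comm, mul_assoc,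
    PowerSeries.inv_mul_cancel _ (P.constantCoeff_charP_ne_zero q), mul_one]

theorem charP_ne_zero : P.charP q ≠ 0 := fun h =>
  P.constantCoeff_charP_ne_zero q (by rw [h, map_zero])

/-- Completing the square: `P ν - P + E/2` squares to the quarter discriminant. The resulting
identity carries an extra factor `P`, which is cancelled. -/
theorem nu_root :
    P.charP q * P.nu q ^ 2 + (P.charE q - 2 * P.charP q) * P.nu q + P.charP q = 0 := by
  refine (mul_eq_zero.1 (?_ : P.charP q * _ = 0)).resolve_left (P.charP_ne_zero q)
  have h1 := P.charP_mul_nu q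
  have h2 := P.discriminant q
  have hh : PowerSeries.C (1 / 2 : ℂ) * 2 = 1 := by
    rw [← map_ofNat (PowerSeries.C (R := ℂ)) 2, ← map_mul]; norm_num
  have hq : PowerSeries.C (1 / 4 : ℂ) = PowerSeries.C (1 / 2 : ℂ) ^ 2 := by
    rw [← map_pow]; norm_num
  rw [hq] at h2
  have h3 : PowerSeries.C (P.cq q / P.hx : ℂ) * PowerSeries.mk (P.R q)
      = P.charP q * P.nu q - P.charP q + PowerSeries.C (1 / 2 : ℂ) * P.charE q := by
    rw [h1]; ring
  rw [h3] at h2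
  linear_combination h2 + (P.charE q * P.charP q * (1 - P.nu q)) * hh

/-- At the constant coefficient the square root is `(c_q/h_x) c_{1q}`, whose imaginary part is
nonnegative, so `norm_root_lt_one` applies. -/
theorem norm_constantCoeff_nu_lt_one : ‖PowerSeries.constantCoeff (P.nu q)‖ < 1 := by
  have h1 := congrArg PowerSeries.constantCoeff (P.charP_mul_nu q)
  have h2 := congrArg PowerSeries.constantCoeff (P.discriminant q)
  simp only [map_mul, map_add, map_sub, map_pow, PowerSeries.constantCoeff_C, constantCoeff_charE]
    at h1 h2
  have hR : PowerSeries.constantCoeff (PowerSeries.mk (P.R q)) = P.c1q q := by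
    rw [← PowerSeries.coeff_zero_eq_constantCoeff_apply, PowerSeries.coeff_mk, R]
  rw [hR] at h1 h2
  refine norm_root_lt_one (P.theta_pos q) (P.theta_lt q) (P.dq_pos q) (P.e0_im_pos q)
    (P.constantCoeff_charP q) (ρ := (P.cq q / P.hx : ℂ) * P.c1q q) ?_ ?_ ?_
  · rw [← Complex.ofReal_div, Complex.im_ofReal_mul]
    exact mul_nonneg (div_pos (P.cq_pos q) P.hx_pos).le (P.c1q_im_nonneg q)
  · rw [h1]; ring
  · rw [mul_pow, ← mul_pow, h2]; ring

end Setup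

/-! ### The one-dimensional scheme on the half-line -/

/-- The average `I + θ h² ∂ ∂̄`. -/
noncomputable def sTheta (θ h : ℝ) (Z : ℕ → ℂ) (j : ℕ) : ℂ := Z j + θ * h ^ 2 * fwd h (bwd h Z) j

theorem fwd_bwd {h : ℝ} (hh : h ≠ 0) (Z : ℕ → ℂ) (j : ℕ) :
    fwd h (bwd h Z) j = (Z (j + 1) - 2 * Z j + Z (j - 1)) / h ^ 2 := by
  have : (h : ℂ) ≠ 0 := by exact_mod_cast hh
  simp only [fwd, bwd, Nat.add_sub_cancel]
  field_simp
  ring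

theorem sTheta_eq {θ h : ℝ} (hh : h ≠ 0) (Z : ℕ → ℂ) (j : ℕ) :
    sTheta θ h Z j = (1 - 2 * θ) * Z j + θ * (Z (j + 1) + Z (j - 1)) := by
  have : (h : ℂ) ≠ 0 := by exact_mod_cast hh
  rw [sTheta, fwd_bwd hh]
  field_simp
  ring

namespace Setup

variable (P : Setup) (q : ℕ)

/-- The auxiliary potential of the equation for the `q`-th sine coefficient. -/
noncomputable def VtMeshq (j : ℕ) : ℝ := P.VtMesh j + P.c * (P.lam q / P.sig q)

/-- The equation at `x_j` for the `q`-th sine coefficients of the main step. -/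
def MainStepq (A B g : ℕ → ℂ) (j : ℕ) : Prop :=
  Complex.I * P.hbar * sTheta (P.theta q) P.hx (fun j => (B j - A j) / P.tau) j
    = -P.cq q * fwd P.hx (bwd P.hx fun j => (B j + A j) / 2) j
      + sTheta (P.theta q) P.hx (fun j => P.VtMeshq q j * ((B j + A j) / 2)) j + g j

theorem VtMeshq_far {j : ℕ} (hj : P.J - 1 ≤ j) : P.VtMeshq q j = P.Vinfq q := by
  rw [VtMeshq, VtMesh_far P hj, Vinfq]

theorem inner_real_mul_self_im (w : ℝ) (z : ℂ) : (⟪(w : ℂ) * (z / 2), z⟫_ℂ).im = 0 := by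
  rw [div_eq_inv_mul, ← Complex.ofReal_ofNat, ← Complex.ofReal_inv]
  simp only [RCLike.inner_apply, map_mul, Complex.conj_ofReal, Complex.mul_im, Complex.mul_re,
    Complex.ofReal_re, Complex.ofReal_im, Complex.conj_re, Complex.conj_im]
  ring

/-- Stability of one step on the half-line. -/
theorem sqrt_tsum_le_of_mainStepq {A B g : ℕ → ℂ} (hA0 : A 0 = 0) (hB0 : B 0 = 0)
    (hA : Summable fun i => ‖A (i + 1)‖ ^ 2) (hB : Summable fun i => ‖B (i + 1)‖ ^ 2)
    (hg : Summable fun i => ‖g (i + 1)‖ ^ 2) (h : ∀ i, P.MainStepq q A B g (i + 1)) :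
    √(∑' i, ‖B (i + 1)‖ ^ 2) ≤ √(∑' i, ‖A (i + 1)‖ ^ 2)
      + √(∑' i, ‖g (i + 1)‖ ^ 2) / (P.hbar / P.tau * (1 - 4 * P.theta q)) := by
  let a : Seq2 := ⟨fun i => A (i + 1), memlp_two_iff.2 hA⟩
  let b : Seq2 := ⟨fun i => B (i + 1), memlp_two_iff.2 hB⟩
  let γ : Seq2 := ⟨fun i => g (i + 1), memlp_two_iff.2 hg⟩
  obtain ⟨C, hC⟩ := P.exists_abs_VtMesh_le
  have hC' : ∀ j, |P.VtMeshq q j| ≤ C + |P.c * (P.lam q / P.sig q)| := fun j =>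
    (abs_add_le _ _).trans (by gcongr; exact hC j)
  set C' := C + |P.c * (P.lam q / P.sig q)|
  have hv : Summable fun i => ‖(P.VtMeshq q (i + 1) : ℂ) * ((a + b) i / 2)‖ ^ 2 := by
    have h1 := (memlp_two_iff.1 (lp.memℓp (a + b))).mul_left (C' ^ 2)
    refine Summable.of_nonneg_of_le (fun _ => by positivity) (fun i => ?_) h1
    rw [norm_mul, mul_pow, Complex.norm_real, Real.norm_eq_abs, norm_div]
    have h2 : ‖(a + b) i‖ / ‖(2 : ℂ)‖ ≤ ‖(a + b) i‖ := by
      rw [Complex.norm_ofNat]; linarith [norm_nonneg ((a + b) i)]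
    gcongr
    exact hC' _
  let v : Seq2 := ⟨fun i => (P.VtMeshq q (i + 1) : ℂ) * ((a + b) i / 2), memlp_two_iff.2 hv⟩
  have na : √(∑' i, ‖A (i + 1)‖ ^ 2) = ‖a‖ := by
    rw [← Real.sqrt_sq (norm_nonneg a), seq2_norm_sq]
  have nb : √(∑' i, ‖B (i + 1)‖ ^ 2) = ‖b‖ := by
    rw [← Real.sqrt_sq (norm_nonneg b), seq2_norm_sq]
  have ng : √(∑' i, ‖g (i + 1)‖ ^ 2) = ‖γ‖ := by
    rw [← Real.sqrt_sq (norm_nonneg γ), seq2_norm_sq]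
  have hvin : (⟪v, a + b⟫_ℂ).im = 0 := by
    rw [lp.inner_eq_tsum, Complex.im_tsum (lp.summable_inner _ _)]
    refine (tsum_congr fun i => ?_).trans tsum_zero
    change (⟪(P.VtMeshq q (i + 1) : ℂ) * ((a + b) i / 2), (a + b) i⟫_ℂ).im = 0
    exact inner_real_mul_self_im _ _
  rw [na, nb, ng]
  have hh := P.hx_pos.ne'
  have hhC : (P.hx : ℂ) ≠ 0 := by exact_mod_cast hh
  have htC : (P.tau : ℂ) ≠ 0 := by exact_mod_cast P.tau_pos.ne'
  have hθC : (P.theta q : ℂ) ≠ 0 := by exact_mod_cast (P.theta_pos q).ne'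
  -- The value of `r` comes from `∂_x ∂̄_x = (S - 1)/(θ h_x²)`: half of `c_q/(θ h_x²)` multiplies `A
  -- + B`.
  refine norm_le_of_step inner_neighbourSum norm_neighbourSum_le (P.theta_pos q) (P.theta_lt q)
    (div_pos P.hbar_pos P.tau_pos) (r := P.cq q / (2 * P.theta q * P.hx ^ 2))
    (div_pos (P.cq_pos q) (by have := P.theta_pos q; have := P.hx_pos; positivity))
    a b v γ hvin ?_
  ext i
  have hi := h i
  rw [MainStepq, fwd_bwd hh, sTheta_eq hh, sTheta_eq hh] at hi
  have hav : ∀ u : Seq2, avg (P.theta q) neighbourSum u i = (1 - 2 * P.theta q) * u i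
      + P.theta q * (u (i + 1) + if i = 0 then 0 else u (i - 1)) := by
    intro u
    rw [avg, lp.coeFn_add, Pi.add_apply, lp.coeFn_smul, lp.coeFn_smul, Pi.smul_apply,
      Pi.smul_apply, neighbourSum_apply, smul_eq_mul, smul_eq_mul]
    push_cast
    rfl
  have hu : ∀ l, ((Complex.I * ((P.hbar / P.tau : ℝ) : ℂ)) • (b - a) - v
      + ((P.cq q / (2 * P.theta q * P.hx ^ 2) : ℝ) : ℂ) • (a + b) : Seq2) l
      = Complex.I * ((P.hbar / P.tau : ℝ) : ℂ) * (B (l + 1) - A (l + 1))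
        - P.VtMeshq q (l + 1) * ((A (l + 1) + B (l + 1)) / 2)
        + ((P.cq q / (2 * P.theta q * P.hx ^ 2) : ℝ) : ℂ) * (A (l + 1) + B (l + 1)) :=
    fun l => rfl
  rw [hav, hu, hu]
  have hr : (((P.cq q / (2 * P.theta q * P.hx ^ 2) : ℝ) : ℂ) • (a + b) + γ : Seq2) i
      = ((P.cq q / (2 * P.theta q * P.hx ^ 2) : ℝ) : ℂ) * (A (i + 1) + B (i + 1)) + g (i + 1) :=
    rfl
  rw [hr]
  -- The index `i` of `ℓ²` is the node `i + 1`. The missing left neighbour at `i = 0` is the node 0,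
  -- where `A` and `B` vanish.
  have hlast : (if i = 0 then 0 else ((Complex.I * ((P.hbar / P.tau : ℝ) : ℂ)) • (b - a) - v
      + ((P.cq q / (2 * P.theta q * P.hx ^ 2) : ℝ) : ℂ) • (a + b) : Seq2) (i - 1))
      = Complex.I * ((P.hbar / P.tau : ℝ) : ℂ) * (B i - A i)
        - P.VtMeshq q i * ((A i + B i) / 2)
        + ((P.cq q / (2 * P.theta q * P.hx ^ 2) : ℝ) : ℂ) * (A i + B i) := by
    rcases i with _ | i
    · simp [hA0, hB0]
    · rw [if_neg (Nat.succ_ne_zero i), Nat.add_sub_cancel, hu]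
  rw [hlast]
  simp only [Nat.add_sub_cancel] at hi
  have key : g (i + 1) = Complex.I * P.hbar * ((1 - 2 * P.theta q) *
      ((B (i + 1) - A (i + 1)) / P.tau) + P.theta q * ((B (i + 1 + 1) - A (i + 1 + 1)) / P.tau
        + (B i - A i) / P.tau)) - (-P.cq q * (((B (i + 1 + 1) + A (i + 1 + 1)) / 2
        - 2 * ((B (i + 1) + A (i + 1)) / 2) + (B i + A i) / 2) / P.hx ^ 2)
      + ((1 - 2 * P.theta q) * (P.VtMeshq q (i + 1) * ((B (i + 1) + A (i + 1)) / 2))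
        + P.theta q * (P.VtMeshq q (i + 1 + 1) * ((B (i + 1 + 1) + A (i + 1 + 1)) / 2)
          + P.VtMeshq q i * ((B i + A i) / 2)))) := by
    linear_combination -hi
  rw [key]
  push_cast
  field_simp
  ring

/-! ### Continuation beyond the artificial boundary -/

/-- Continuation to the half-line, at the time level `m`, of a function `B` of `j ≤ J`, with the
boundary values on all the levels collected in the generating function `Φ`. -/
noncomputable def cont (Φ : ℂ⟦X⟧) (m : ℕ) (B : ℕ → ℂ) (j : ℕ) : ℂ :=
  if j ≤ P.J then B j else PowerSeries.coeff m (P.nu q ^ (j - P.J) * Φ)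

/-- The sum of squares of the continuation beyond the artificial boundary. -/
noncomputable def tail (Φ : ℂ⟦X⟧) (m : ℕ) : ℝ :=
  ∑' i, ‖PowerSeries.coeff m (P.nu q ^ (i + 1) * Φ)‖ ^ 2

theorem tail_nonneg (Φ : ℂ⟦X⟧) (m : ℕ) : 0 ≤ P.tail q Φ m := tsum_nonneg fun _ => by positivity

theorem tail_eq_zero {Φ : ℂ⟦X⟧} (h : PowerSeries.constantCoeff Φ = 0) : P.tail q Φ 0 = 0 := by
  refine (tsum_congr fun i => ?_).trans tsum_zero
  simp [h]

variable {q}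

theorem cont_of_le {Φ : ℂ⟦X⟧} {m : ℕ} {B : ℕ → ℂ} {j : ℕ} (hj : j ≤ P.J) :
    P.cont q Φ m B j = B j := if_pos hj

theorem cont_add {Φ : ℂ⟦X⟧} {m : ℕ} {B : ℕ → ℂ} (h : PowerSeries.coeff m Φ = B P.J) (i : ℕ) :
    P.cont q Φ m B (P.J + i) = PowerSeries.coeff m (P.nu q ^ i * Φ) := by
  rcases i with _ | i
  · simp [cont, h]
  · rw [cont, if_neg (by omega), Nat.add_sub_cancel_left]

theorem hasSum_cont (Φ : ℂ⟦X⟧) (m : ℕ) (B : ℕ → ℂ) :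
    HasSum (fun i => ‖P.cont q Φ m B (i + 1)‖ ^ 2)
      (∑ j ∈ Finset.Icc 1 P.J, ‖B j‖ ^ 2 + P.tail q Φ m) := by
  have hs : Summable fun i => ‖PowerSeries.coeff m (P.nu q ^ (i + 1) * Φ)‖ ^ 2 :=
    (summable_nat_add_iff 1).2 (summable_sq_coeff_pow_mul (P.norm_constantCoeff_nu_lt_one q) m Φ)
  have h1 : ∀ i, ‖PowerSeries.coeff m (P.nu q ^ (i + 1) * Φ)‖ ^ 2
      = ‖P.cont q Φ m B (i + P.J + 1)‖ ^ 2 := by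
    intro i
    rw [cont, if_neg (by omega), show i + P.J + 1 - P.J = i + 1 by omega]
  have h2 : ∑ j ∈ Finset.Icc 1 P.J, ‖B j‖ ^ 2
      = ∑ i ∈ Finset.range P.J, ‖P.cont q Φ m B (i + 1)‖ ^ 2 := by
    rw [Finset.range_eq_Ico, Finset.sum_Ico_add' (fun j => ‖P.cont q Φ m B j‖ ^ 2) 0 P.J 1, zero_add]
    refine Finset.sum_congr rfl fun j hj => ?_
    rw [P.cont_of_le (by simp at hj; omega)]
  have hs' : Summable fun i => ‖P.cont q Φ m B (i + 1)‖ ^ 2 :=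
    (summable_nat_add_iff P.J).1 (hs.congr h1)
  rw [h2, tail, tsum_congr h1, hs'.sum_add_tsum_nat_add P.J]
  exact hs'.hasSum

/-- Multiplication by a linear symbol couples the levels `k + 1` and `k`, as one Crank–Nicolson step
does. -/
theorem coeff_linear_mul (a b : ℂ) (f : ℂ⟦X⟧) (k : ℕ) :
    PowerSeries.coeff (k + 1) ((PowerSeries.C a + PowerSeries.C b * PowerSeries.X) * f)
      = a * PowerSeries.coeff (k + 1) f + b * PowerSeries.coeff k f := by
  rw [add_mul, mul_assoc, map_add, PowerSeries.coeff_C_mul, PowerSeries.coeff_C_mul,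
    PowerSeries.coeff_succ_X_mul]

/-- The equation of the scheme in a zone of constant potential. -/
theorem mainStepq_iff_of_far {A B g : ℕ → ℂ} {j : ℕ} (hj : P.J ≤ j) (hg : g j = 0) :
    P.MainStepq q A B g j ↔
      (P.theta q * P.e0 q + P.dq q) * (B (j + 1) + B (j - 1))
        + (P.e0 q - 2 * (P.theta q * P.e0 q + P.dq q)) * B j
        + ((P.theta q * P.e1 q + P.dq q) * (A (j + 1) + A (j - 1))
        + (P.e1 q - 2 * (P.theta q * P.e1 q + P.dq q)) * A j) = 0 := by
  have hh := P.hx_pos.ne'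
  have hhC : (P.hx : ℂ) ≠ 0 := by exact_mod_cast hh
  have htC : (P.tau : ℂ) ≠ 0 := by exact_mod_cast P.tau_pos.ne'
  rw [MainStepq, fwd_bwd hh, sTheta_eq hh, sTheta_eq hh, VtMeshq_far P q (by omega),
    VtMeshq_far P q (by omega), VtMeshq_far P q (by omega), hg, ← sub_eq_zero]
  refine Eq.congr ?_ rfl
  rw [e0, e1, dq]
  push_cast
  field_simp
  ring

variable (q) in
/-- The transparent boundary condition for the `q`-th sine coefficients. -/
def TBCq (Φ : ℂ⟦X⟧) (k : ℕ) (A B : ℕ → ℂ) : Prop :=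
  P.cq q * bwd P.hx (fun j => (B j + A j) / 2) P.J
    - P.hx * sMinus (P.theta q)
      (fun j => Complex.I * P.hbar * ((B j - A j) / P.tau)
        - P.Vinfq q * ((A j + B j) / 2)) P.J
    = P.cq q * PowerSeries.coeff (k + 1) (PowerSeries.mk (P.R q) * Φ)

/-- The equation at `j < J` is the given one. At `j = J` it is `charP_mul_nu` combined with the
boundary condition, and at `j > J` it is the characteristic equation times `ν^i Φ`. -/
theorem mainStepq_cont {Φ : ℂ⟦X⟧} {k : ℕ} {A B g : ℕ → ℂ}
    (hΦA : PowerSeries.coeff k Φ = A P.J) (hΦB : PowerSeries.coeff (k + 1) Φ = B P.J)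
    (heq : ∀ j, 1 ≤ j → j ≤ P.J - 1 → P.MainStepq q A B g j)
    (hg : ∀ j, P.J ≤ j → g j = 0) (htbc : P.TBCq q Φ k A B) {j : ℕ} (hj : 1 ≤ j) :
    P.MainStepq q (P.cont q Φ k A) (P.cont q Φ (k + 1) B) g j := by
  have hJ := P.two_le_J
  rcases lt_trichotomy j P.J with hlt | rfl | hgt
  · have h1 := heq j hj (by omega)
    rw [MainStepq] at h1 ⊢
    simp only [sTheta, fwd, bwd] at h1 ⊢
    simp only [P.cont_of_le (show j + 1 - 1 ≤ P.J by omega),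
      P.cont_of_le (show j + 1 ≤ P.J by omega), P.cont_of_le (show j ≤ P.J by omega),
      P.cont_of_le (show j - 1 ≤ P.J by omega)]
    exact h1
  · rw [P.mainStepq_iff_of_far le_rfl (hg _ le_rfl), P.cont_add hΦA 1, P.cont_add hΦB 1,
      P.cont_of_le le_rfl, P.cont_of_le le_rfl, P.cont_of_le (Nat.sub_le _ _),
      P.cont_of_le (Nat.sub_le _ _), pow_one]
    have h1 := congrArg (fun f => PowerSeries.coeff (k + 1) (f * Φ)) (P.charP_mul_nu q)
    have h2 : (P.charP q - PowerSeries.C (1 / 2 : ℂ) * P.charE q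
        + PowerSeries.C (P.cq q / P.hx : ℂ) * PowerSeries.mk (P.R q)) * Φ
        = P.charP q * Φ - PowerSeries.C (1 / 2 : ℂ) * (P.charE q * Φ)
          + PowerSeries.C (P.cq q / P.hx : ℂ) * (PowerSeries.mk (P.R q) * Φ) := by ring
    simp only [h2] at h1
    rw [mul_assoc, map_add, map_sub, PowerSeries.coeff_C_mul, PowerSeries.coeff_C_mul, charP, charE,
      coeff_linear_mul, coeff_linear_mul, coeff_linear_mul, hΦA, hΦB] at h1
    rw [TBCq] at htbc
    simp only [bwd, sMinus] at htbc
    have hhC : (P.hx : ℂ) ≠ 0 := by exact_mod_cast P.hx_pos.ne'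
    have htC : (P.tau : ℂ) ≠ 0 := by exact_mod_cast P.tau_pos.ne'
    have h3 : (P.cq q / P.hx : ℂ)
        * PowerSeries.coeff (k + 1) (PowerSeries.mk (P.R q) * Φ)
        = (P.cq q * PowerSeries.coeff (k + 1) (PowerSeries.mk (P.R q) * Φ)) / P.hx := by ring
    rw [h3, ← htbc] at h1
    -- Solving the boundary condition for the fictitious values at `J + 1` yields the scheme at `J`.
    have h4 : ((P.theta q * P.e0 q + P.dq q) * PowerSeries.coeff (k + 1) (P.nu q * Φ)
        + (P.theta q * P.e1 q + P.dq q) * PowerSeries.coeff k (P.nu q * Φ))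
        = (2 * (P.theta q * P.e0 q + P.dq q) - P.e0 q) * B P.J
          + (2 * (P.theta q * P.e1 q + P.dq q) - P.e1 q) * A P.J
          - (P.theta q * P.e0 q + P.dq q) * B (P.J - 1)
          - (P.theta q * P.e1 q + P.dq q) * A (P.J - 1) := by
      rw [h1, e0, e1, dq]
      push_cast
      field_simp
      ring
    linear_combination h4
  · obtain ⟨i, rfl⟩ : ∃ i, j = P.J + i + 1 := ⟨j - P.J - 1, by omega⟩
    rw [P.mainStepq_iff_of_far (by omega) (hg _ (by omega)), Nat.add_sub_cancel,
      show P.J + i + 1 + 1 = P.J + (i + 2) by ring, show P.J + i + 1 = P.J + (i + 1) by ring,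
      P.cont_add hΦA, P.cont_add hΦB, P.cont_add hΦA, P.cont_add hΦB, P.cont_add hΦA,
      P.cont_add hΦB]
    have h1 : P.charP q * (P.nu q ^ (i + 2) * Φ) + P.charP q * (P.nu q ^ i * Φ)
        + P.charE q * (P.nu q ^ (i + 1) * Φ)
        - PowerSeries.C (2 : ℂ) * (P.charP q * (P.nu q ^ (i + 1) * Φ)) = 0 := by
      rw [map_ofNat]
      linear_combination (P.nu q ^ i * Φ) * P.nu_root q
    have h2 := congrArg (PowerSeries.coeff (k + 1)) h1
    rw [map_sub, map_add, map_add, PowerSeries.coeff_C_mul, charP, charE, coeff_linear_mul,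
      coeff_linear_mul, coeff_linear_mul, coeff_linear_mul, map_zero] at h2
    linear_combination h2

/-- Stability of one step for the `q`-th sine coefficients. -/
theorem sqrt_energy_le {Φ : ℂ⟦X⟧} {k : ℕ} {A B g : ℕ → ℂ} (hA0 : A 0 = 0) (hB0 : B 0 = 0)
    (hΦA : PowerSeries.coeff k Φ = A P.J) (hΦB : PowerSeries.coeff (k + 1) Φ = B P.J)
    (heq : ∀ j, 1 ≤ j → j ≤ P.J - 1 →
      P.MainStepq q A B (fun j => g j / P.sig q) j) (htbc : P.TBCq q Φ k A B) :
    √(∑ j ∈ Finset.Icc 1 P.J, ‖B j‖ ^ 2 + P.tail q Φ (k + 1))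
      ≤ √(∑ j ∈ Finset.Icc 1 P.J, ‖A j‖ ^ 2 + P.tail q Φ k)
        + 3 * P.tau / P.hbar * √(∑ j ∈ Finset.Icc 1 (P.J - 1), ‖g j‖ ^ 2) := by
  have hJ := P.two_le_J
  -- The free term is extended by zero, since the continued equation at `j ≥ J` is homogeneous.
  set γ : ℕ → ℂ := fun j => if j ≤ P.J - 1 then g j / P.sig q else 0 with hγ
  have hsum : HasSum (fun i => ‖γ (i + 1)‖ ^ 2)
      (∑ j ∈ Finset.Icc 1 (P.J - 1), ‖g j‖ ^ 2 / P.sig q ^ 2) := by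
    have h1 : ∑ j ∈ Finset.Icc 1 (P.J - 1), ‖g j‖ ^ 2 / P.sig q ^ 2
        = ∑ i ∈ Finset.range (P.J - 1), ‖γ (i + 1)‖ ^ 2 := by
      rw [Finset.range_eq_Ico, Finset.sum_Ico_add' (fun j => ‖γ j‖ ^ 2) 0 (P.J - 1) 1, zero_add]
      refine Finset.sum_congr rfl fun j hj => ?_
      have : γ j = g j / P.sig q := if_pos (by simp at hj; omega)
      rw [this, norm_div, div_pow, Complex.norm_real, Real.norm_eq_abs, sq_abs]
    rw [h1]
    refine hasSum_sum_of_ne_finset_zero fun i hi => ?_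
    rw [Finset.mem_range, not_lt] at hi
    have : γ (i + 1) = 0 := if_neg (by omega)
    simp [this]
  have h := P.sqrt_tsum_le_of_mainStepq q (A := P.cont q Φ k A) (B := P.cont q Φ (k + 1) B) (g := γ)
    ((P.cont_of_le (Nat.zero_le _)).trans hA0) ((P.cont_of_le (Nat.zero_le _)).trans hB0)
    (P.hasSum_cont Φ k A).summable (P.hasSum_cont Φ (k + 1) B).summable hsum.summable
    (fun i => P.mainStepq_cont hΦA hΦB (fun j h1 h2 => by
        have := heq j h1 h2
        rw [MainStepq] at this ⊢
        rw [this]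
        simp only [if_pos h2])
      (fun j hj => if_neg (by omega)) htbc (Nat.succ_pos i))
  rw [(P.hasSum_cont Φ k A).tsum_eq, (P.hasSum_cont Φ (k + 1) B).tsum_eq, hsum.tsum_eq] at h
  refine h.trans (add_le_add le_rfl ?_)
  have hs := P.sig_pos q
  have h3 := P.one_third_le q
  have ht := P.tau_pos
  have hh := P.hbar_pos
  rw [← Finset.sum_div, Real.sqrt_div' _ (by positivity), Real.sqrt_sq hs.le]
  have h4 : 0 < 1 - 4 * P.theta q := by linarith [P.theta_lt q]
  rw [div_div, div_le_iff₀ (by positivity)]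
  set S := √(∑ j ∈ Finset.Icc 1 (P.J - 1), ‖g j‖ ^ 2)
  have hS : 0 ≤ S := Real.sqrt_nonneg _
  have : 3 * P.tau / P.hbar * S * (P.sig q * (P.hbar / P.tau * (1 - 4 * P.theta q)))
      = S * (3 * (P.sig q * (1 - 4 * P.theta q))) := by field_simp
  rw [this]
  nlinarith

end Setup

/-! ### The discrete sine transform -/

theorem two_sin_mul_sum_cos (x : ℝ) (N : ℕ) :
    2 * Real.sin (x / 2) * ∑ k ∈ Finset.range N, Real.cos (k * x)
      = Real.sin (N * x - x / 2) + Real.sin (x / 2) := by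
  induction N with
  | zero => simp
  | succ N ih =>
    rw [Finset.sum_range_succ, mul_add, ih]
    push_cast
    rw [show ((N : ℝ) + 1) * x - x / 2 = N * x + x / 2 by ring, Real.sin_sub, Real.sin_add]
    ring

/-- The range of `n` keeps `sin(πn/(2K))` nonzero, so it can be divided out of the telescoped sum.
-/
theorem sum_cos_eq {K n : ℕ} (hn : 0 < n) (hnK : n < 2 * K) :
    ∑ k ∈ Finset.range K, Real.cos (k * (Real.pi * n / K)) = (1 - (-1) ^ n) / 2 := by
  have hK : (0 : ℝ) < K := by exact_mod_cast (by omega : 0 < K)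
  have hn' : (0 : ℝ) < n := by exact_mod_cast hn
  have hnK' : (n : ℝ) < 2 * K := by exact_mod_cast hnK
  have hpi := Real.pi_pos
  have hs : 0 < Real.sin (Real.pi * n / K / 2) := by
    refine Real.sin_pos_of_pos_of_lt_pi (by positivity) ?_
    rw [div_div, div_lt_iff₀ (by positivity)]
    nlinarith
  have h := two_sin_mul_sum_cos (Real.pi * n / K) K
  rw [show (K : ℝ) * (Real.pi * n / K) = n * Real.pi by field_simp, Real.sin_sub,
    Real.sin_nat_mul_pi, Real.cos_nat_mul_pi] at h
  have : Real.sin (Real.pi * n / K / 2) * (2 * ∑ k ∈ Finset.range K,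
      Real.cos (k * (Real.pi * n / K)) - (1 - (-1) ^ n)) = 0 := by linear_combination h
  have := (mul_eq_zero.1 this).resolve_left hs.ne'
  linarith

/-- Product to sum: `p + q` and `p - q` have the same parity, so for `p ≠ q` the two cosine sums are
equal and cancel. -/
theorem sum_sin_mul_sin {K p q : ℕ} (hp : 1 ≤ p) (hpK : p ≤ K - 1) (hq : 1 ≤ q)
    (hqK : q ≤ K - 1) :
    ∑ k ∈ Finset.Icc 1 (K - 1), Real.sin (Real.pi * p * k / K) * Real.sin (Real.pi * q * k / K)
      = if p = q then (K : ℝ) / 2 else 0 := by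
  have h0 : ∀ p q : ℕ, ∑ k ∈ Finset.Icc 1 (K - 1),
      Real.sin (Real.pi * p * k / K) * Real.sin (Real.pi * q * k / K)
      = ∑ k ∈ Finset.range K, Real.sin (Real.pi * p * k / K) * Real.sin (Real.pi * q * k / K) := by
    intro p q
    refine Finset.sum_subset (fun k hk => by simp at hk ⊢; omega) fun k hk hk' => ?_
    have : k = 0 := by simp at hk hk'; omega
    simp [this]
  rw [h0]
  wlog hpq : q ≤ p generalizing p q
  · have := this hq hqK hp hpK (by omega)
    simp only [mul_comm (Real.sin (Real.pi * p * _ / K)), this, eq_comm]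
  have h1 : ∀ k : ℕ, Real.sin (Real.pi * p * k / K) * Real.sin (Real.pi * q * k / K)
      = Real.cos (k * (Real.pi * (p - q : ℕ) / K)) / 2
        - Real.cos (k * (Real.pi * (p + q : ℕ) / K)) / 2 := by
    intro k
    rw [Nat.cast_sub hpq, Nat.cast_add,
      show (k : ℝ) * (Real.pi * (p - q) / K) = Real.pi * p * k / K - Real.pi * q * k / K by ring,
      show (k : ℝ) * (Real.pi * (p + q) / K) = Real.pi * p * k / K + Real.pi * q * k / K by ring,
      Real.cos_sub, Real.cos_add]
    ring
  rw [Finset.sum_congr rfl fun k _ => h1 k, Finset.sum_sub_distrib, ← Finset.sum_div,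
    ← Finset.sum_div, sum_cos_eq (n := p + q) (by omega) (by omega)]
  split_ifs with h
  · subst h
    simp [← two_mul]
  · rw [sum_cos_eq (by omega) (by omega)]
    have : (-1 : ℝ) ^ (p + q) = (-1) ^ (p - q) := by
      rw [show p + q = (p - q) + 2 * q by omega, pow_add, pow_mul]; simp
    rw [this, sub_self]

theorem sineCoeff_add (K : ℕ) (Z Z' : ℕ → ℂ) (q : ℕ) :
    sineCoeff K (Z + Z') q = sineCoeff K Z q + sineCoeff K Z' q := by
  simp only [sineCoeff, Pi.add_apply, add_mul, Finset.sum_add_distrib, mul_add]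

theorem sineCoeff_smul (K : ℕ) (a : ℂ) (Z : ℕ → ℂ) (q : ℕ) :
    sineCoeff K (a • Z) q = a * sineCoeff K Z q := by
  simp only [sineCoeff, Pi.smul_apply, smul_eq_mul, mul_assoc, ← Finset.mul_sum]
  ring

theorem sineCoeff_sub (K : ℕ) (Z Z' : ℕ → ℂ) (q : ℕ) :
    sineCoeff K (Z - Z') q = sineCoeff K Z q - sineCoeff K Z' q := by
  simp only [sineCoeff, Pi.sub_apply, sub_mul, Finset.sum_sub_distrib, mul_sub]

theorem sineCoeff_congr {K : ℕ} {Z Z' : ℕ → ℂ} (h : ∀ k, 1 ≤ k → k ≤ K - 1 → Z k = Z' k) (q : ℕ) :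
    sineCoeff K Z q = sineCoeff K Z' q := by
  rw [sineCoeff, sineCoeff]
  congr 1
  refine Finset.sum_congr rfl fun k hk => ?_
  rw [Finset.mem_Icc] at hk
  rw [h k hk.1 hk.2]

theorem sineCoeff_eq_zero {K : ℕ} {Z : ℕ → ℂ} (h : ∀ k, 1 ≤ k → k ≤ K - 1 → Z k = 0) (q : ℕ) :
    sineCoeff K Z q = 0 := by
  rw [sineCoeff_congr (Z' := fun _ => 0) h, sineCoeff]
  simp

/-- Parseval's equality. -/
theorem sum_norm_sineCoeff_sq (K : ℕ) (Z : ℕ → ℂ) :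
    ∑ q ∈ Finset.Icc 1 (K - 1), ‖sineCoeff K Z q‖ ^ 2
      = 2 / K * ∑ k ∈ Finset.Icc 1 (K - 1), ‖Z k‖ ^ 2 := by
  rcases Nat.eq_zero_or_pos K with rfl | hK
  · simp
  have hK' : (K : ℂ) ≠ 0 := by exact_mod_cast hK.ne'
  set s : ℕ → ℕ → ℂ := fun q k => (Real.sin (Real.pi * q * k / K) : ℂ) with hs
  -- Orthogonality is used with the frequency as summation variable; `sin(πqk/K)` is symmetric in
  -- `q` and `k`.
  have hsym : ∀ k ∈ Finset.Icc 1 (K - 1), ∀ l ∈ Finset.Icc 1 (K - 1),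
      ∑ q ∈ Finset.Icc 1 (K - 1), s q k * s q l = if k = l then (K : ℂ) / 2 else 0 := by
    intro k hk l hl
    rw [Finset.mem_Icc] at hk hl
    have := sum_sin_mul_sin hk.1 hk.2 hl.1 hl.2
    have h2 := congrArg (fun r : ℝ => (r : ℂ)) this
    push_cast at h2
    rw [show (if k = l then (K : ℂ) / 2 else 0) = ((if k = l then (K : ℝ) / 2 else 0 : ℝ) : ℂ) by
      split_ifs <;> push_cast <;> rfl]
    rw [← h2]
    refine Finset.sum_congr rfl fun q _ => ?_
    simp only [hs]
    push_cast
    ring_nf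
  have hterm : ∀ q, ((‖sineCoeff K Z q‖ : ℂ)) ^ 2 = (2 / (K : ℂ)) ^ 2 *
      ∑ k ∈ Finset.Icc 1 (K - 1), ∑ l ∈ Finset.Icc 1 (K - 1),
        Z k * (starRingEnd ℂ) (Z l) * (s q k * s q l) := by
    intro q
    rw [← Complex.mul_conj', sineCoeff, map_mul, map_sum, map_div₀, map_ofNat, map_natCast]
    rw [show ∀ a b c : ℂ, a * b * (a * c) = a ^ 2 * (b * c) by intros; ring,
      Finset.sum_mul_sum]
    congr 1
    refine Finset.sum_congr rfl fun k _ => Finset.sum_congr rfl fun l _ => ?_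
    rw [map_mul, Complex.conj_ofReal]
    simp only [hs]
    ring
  have : ((∑ q ∈ Finset.Icc 1 (K - 1), ‖sineCoeff K Z q‖ ^ 2 : ℝ) : ℂ)
      = ((2 / K * ∑ k ∈ Finset.Icc 1 (K - 1), ‖Z k‖ ^ 2 : ℝ) : ℂ) := by
    push_cast
    rw [Finset.sum_congr rfl fun q _ => hterm q, ← Finset.mul_sum, Finset.sum_comm]
    rw [Finset.sum_congr rfl (g := fun k => (K : ℂ) / 2 * (‖Z k‖ : ℂ) ^ 2)]
    · rw [← Finset.mul_sum]
      field_simp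
    · intro k hk
      rw [Finset.sum_comm]
      simp only [← Finset.mul_sum]
      rw [Finset.sum_congr rfl fun l hl => by rw [hsym k hk l hl]]
      simp only [mul_ite, mul_zero, Finset.sum_ite_eq, if_pos hk, Complex.mul_conj']
      ring
  exact_mod_cast this

/-- Discrete Green formula, with boundary terms that vanish when both sequences are zero at the
ends. -/
theorem sum_second_difference (Z s : ℕ → ℂ) (N : ℕ) :
    ∑ i ∈ Finset.range N, (Z (i + 2) - 2 * Z (i + 1) + Z i) * s (i + 1)
      = ∑ i ∈ Finset.range N, Z (i + 1) * (s (i + 2) - 2 * s (i + 1) + s i)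
        + (Z (N + 1) * s N - Z N * s (N + 1)) - (Z 1 * s 0 - Z 0 * s 1) := by
  induction N with
  | zero => simp
  | succ N ih => rw [Finset.sum_range_succ, ih, Finset.sum_range_succ]; ring

/-! ### Sine transform of the difference operators -/

namespace Setup

variable (P : Setup)

/-- The sine transform diagonalizes the second difference. -/
theorem sineCoeff_dyy {Z : ℕ → ℂ} (h0 : Z 0 = 0) (hK : Z P.K = 0) (q : ℕ) :
    sineCoeff P.K (fwd P.hy (bwd P.hy Z)) q = -P.lam q * sineCoeff P.K Z q := by
  have hKpos := P.K_pos
  have hh := P.hy_pos.ne'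
  have hhC : (P.hy : ℂ) ≠ 0 := by exact_mod_cast hh
  set s : ℕ → ℂ := fun k => (Real.sin (Real.pi * q * k / P.K) : ℂ) with hs
  obtain ⟨N, hN⟩ : ∃ N, P.K = N + 1 := ⟨P.K - 1, by omega⟩
  have hconv : ∀ f : ℕ → ℂ, ∑ k ∈ Finset.Icc 1 (P.K - 1), f k
      = ∑ i ∈ Finset.range N, f (i + 1) := by
    intro f
    rw [Finset.range_eq_Ico, Finset.sum_Ico_add' f 0 N 1, zero_add, hN, Nat.add_sub_cancel]
    rfl
  have hsN : s (N + 1) = 0 := by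
    simp only [hs]
    rw [← hN, mul_div_assoc, div_self (by exact_mod_cast hKpos.ne'), mul_one, mul_comm,
      Real.sin_nat_mul_pi, Complex.ofReal_zero]
  have hs0 : s 0 = 0 := by simp [hs]
  have hss : ∀ i, s (i + 2) - 2 * s (i + 1) + s i = -(P.hy ^ 2 * P.lam q : ℝ) * s (i + 1) := by
    intro i
    have h1 : P.hy ^ 2 * P.lam q = 2 - 2 * Real.cos (Real.pi * q / P.K) := by
      have hY := P.Y_pos.ne'
      have : Real.pi * q / P.K = 2 * (Real.pi * q * P.hy / (2 * P.Y)) := by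
        rw [hy]; field_simp
      rw [this, Real.cos_two_mul, lam, Real.cos_sq']
      field_simp
      ring
    simp only [hs]
    rw [h1]
    have e1 : Real.sin (Real.pi * q * ((i + 2 : ℕ) : ℝ) / P.K)
        = Real.sin (Real.pi * q * ((i + 1 : ℕ) : ℝ) / P.K + Real.pi * q / P.K) := by
      congr 1; push_cast; ring
    have e2 : Real.sin (Real.pi * q * (i : ℝ) / P.K)
        = Real.sin (Real.pi * q * ((i + 1 : ℕ) : ℝ) / P.K - Real.pi * q / P.K) := by
      congr 1; push_cast; ring
    rw [e1, e2, Real.sin_add, Real.sin_sub]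
    push_cast
    ring
  have hmain := sum_second_difference Z s N
  rw [hsN, hs0, h0, show Z (N + 1) = 0 from hN ▸ hK] at hmain
  simp only [hss] at hmain
  have e5 : ∀ f : ℕ → ℂ, sineCoeff P.K f q
      = 2 / (P.K : ℂ) * ∑ i ∈ Finset.range N, f (i + 1) * s (i + 1) := fun f => by
    rw [sineCoeff, hconv]
  rw [e5, e5]
  have e3 : ∑ i ∈ Finset.range N, fwd P.hy (bwd P.hy Z) (i + 1)
      * s (i + 1)
      = (∑ i ∈ Finset.range N, (Z (i + 2) - 2 * Z (i + 1) + Z i) * s (i + 1)) / P.hy ^ 2 := by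
    rw [Finset.sum_div]
    refine Finset.sum_congr rfl fun i _ => ?_
    rw [fwd_bwd hh, Nat.add_sub_cancel]
    ring
  have e4 : ∑ i ∈ Finset.range N, Z (i + 1) * (-((P.hy ^ 2 * P.lam q : ℝ) : ℂ) * s (i + 1))
      = -((P.hy ^ 2 * P.lam q : ℝ) : ℂ) * ∑ i ∈ Finset.range N, Z (i + 1) * s (i + 1) := by
    rw [Finset.mul_sum]
    exact Finset.sum_congr rfl fun i _ => by ring
  rw [e3, hmain, e4]
  push_cast
  field_simp
  ring

/-- The mesh function vanishes on the horizontal sides of the strip. -/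
def VanishesOnSides (W : MeshFun) (j : ℕ) : Prop := W j 0 = 0 ∧ W j P.K = 0

variable {P}

theorem dxx_row (W : MeshFun) (j : ℕ) :
    dxx P.hx W j = ((P.hx : ℂ) ^ 2)⁻¹ • (W (j + 1) + (-2 : ℂ) • W j + W (j - 1)) := by
  funext k
  rw [dxx, fwd_bwd P.hx_pos.ne']
  simp only [Pi.smul_apply, Pi.add_apply, smul_eq_mul]
  ring

theorem sineCoeff_dxx (W : MeshFun) (j q : ℕ) :
    sineCoeff P.K (dxx P.hx W j) q
      = fwd P.hx (bwd P.hx fun i => sineCoeff P.K (W i) q) j := by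
  rw [dxx_row, fwd_bwd P.hx_pos.ne', sineCoeff_smul, sineCoeff_add, sineCoeff_add, sineCoeff_smul]
  ring

theorem VanishesOnSides.dxx {W : MeshFun} {j : ℕ} (h : P.VanishesOnSides W j)
    (h1 : P.VanishesOnSides W (j - 1)) (h2 : P.VanishesOnSides W (j + 1)) :
    P.VanishesOnSides (dxx P.hx W) j := by
  rw [VanishesOnSides, dxx_row]
  simp [h.1, h.2, h1.1, h1.2, h2.1, h2.2]

/-- The terms in `y` collapse to `σ_q`; factoring it out turns `h_x²/12` into `θ_q h_x²`. -/
theorem sineCoeff_sN {W : MeshFun} {j : ℕ} (h : P.VanishesOnSides W j) (q : ℕ) :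
    sineCoeff P.K (sN P.hx P.hy W j) q
      = P.sig q * sTheta (P.theta q) P.hx (fun i => sineCoeff P.K (W i) q) j := by
  have h1 : sN P.hx P.hy W j = W j + (P.hx ^ 2 / 12 : ℂ) • dxx P.hx W j
      + (P.hy ^ 2 / 12 : ℂ) • fwd P.hy (bwd P.hy (W j)) := rfl
  have h2 : (P.theta q * P.sig q : ℂ) = 1 / 12 := by
    rw [← Complex.ofReal_mul, P.theta_mul_sig]; push_cast; rfl
  have h3 : (P.sig q : ℂ) = 1 - P.hy ^ 2 / 12 * P.lam q := by rw [sig]; push_cast; rfl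
  rw [h1, sineCoeff_add, sineCoeff_add, sineCoeff_smul, sineCoeff_smul, sineCoeff_dxx,
    P.sineCoeff_dyy h.1 h.2, sTheta]
  linear_combination (-(P.hx : ℂ) ^ 2 * fwd P.hx (bwd P.hx fun i => sineCoeff P.K (W i) q) j) * h2
    - sineCoeff P.K (W j) q * h3

/-- The transform gives `σ_q D - λ_q (1 + (h_x²/12) D)` with `D` the second difference in `x`.
Replacing `1/12` by `θ_q` in the last term leaves a multiple of `1 - σ_q = h_y² λ_q/12`; this is the
square correction in `c_{ħ,q}`. -/
theorem sineCoeff_lapN {W : MeshFun} {j : ℕ} (h : P.VanishesOnSides W j)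
    (h1 : P.VanishesOnSides W (j - 1)) (h2 : P.VanishesOnSides W (j + 1)) (q : ℕ) :
    P.c * sineCoeff P.K (lapN P.hx P.hy W j) q
      = P.sig q * (P.cq q * fwd P.hx (bwd P.hx fun i => sineCoeff P.K (W i) q) j
        - P.c * (P.lam q / P.sig q)
          * sTheta (P.theta q) P.hx (fun i => sineCoeff P.K (W i) q) j) := by
  have e1 : lapN P.hx P.hy W j = (dxx P.hx W j
      + (P.hy ^ 2 / 12 : ℂ) • fwd P.hy (bwd P.hy (dxx P.hx W j)))
      + (fwd P.hy (bwd P.hy (W j)) + (P.hx ^ 2 / 12 : ℂ) • dxx P.hx (dyy P.hy W) j) := rfl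
  have hd := h.dxx h1 h2
  have e2 : fwd P.hx (bwd P.hx fun i => sineCoeff P.K (dyy P.hy W i) q) j
      = -P.lam q * fwd P.hx (bwd P.hx fun i => sineCoeff P.K (W i) q) j := by
    rw [fwd_bwd P.hx_pos.ne', fwd_bwd P.hx_pos.ne']
    have : ∀ i, P.VanishesOnSides W i →
        sineCoeff P.K (dyy P.hy W i) q = -P.lam q * sineCoeff P.K (W i) q :=
      fun i hi => P.sineCoeff_dyy hi.1 hi.2 q
    rw [this _ h, this _ h1, this _ h2]
    ring
  rw [e1, sineCoeff_add, sineCoeff_add, sineCoeff_add, sineCoeff_smul, sineCoeff_smul,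
    P.sineCoeff_dyy hd.1 hd.2, P.sineCoeff_dyy h.1 h.2, sineCoeff_dxx, sineCoeff_dxx, e2, sTheta]
  have hs : (P.sig q : ℂ) ≠ 0 := by exact_mod_cast (P.sig_pos q).ne'
  have h3 : (P.sig q : ℂ) = 1 - P.hy ^ 2 / 12 * P.lam q := by rw [sig]; push_cast; rfl
  have h4 : (P.theta q : ℂ) = 1 / (12 * P.sig q) := by rw [theta]; push_cast; rfl
  have h5 : (P.cq q : ℂ) = P.c * (1 + (P.hx * P.hy * P.lam q / (12 * P.sig q)) ^ 2) := by
    rw [cq]; push_cast; rfl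
  rw [h4, h5]
  set D := fwd P.hx (bwd P.hx fun i => sineCoeff P.K (W i) q) j
  field_simp
  have h6 : (P.hy : ℂ) ^ 2 * P.lam q = 12 * (1 - P.sig q) := by rw [h3]; ring
  linear_combination (-(12 * P.sig q + P.lam q * P.hx ^ 2) * P.c * D : ℂ) * h6

theorem vanishes_on_sides {W : MeshFun} (h : ∀ j k, P.dirichlet j k → W j k = 0) {j : ℕ}
    (hj : j ≤ P.J) : P.VanishesOnSides W j := by
  have hK := P.K_pos
  refine ⟨h _ _ ⟨⟨hj, Nat.zero_le _⟩, fun h => ?_, fun h => ?_⟩,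
    h _ _ ⟨⟨hj, le_rfl⟩, fun h => ?_, fun h => ?_⟩⟩
  · exact absurd h.2.2.1 (by omega)
  · exact absurd h.2.1 (by omega)
  · exact absurd h.2.2.2 (by omega)
  · exact absurd h.2.2 (by omega)

theorem sineCoeff_left {W : MeshFun} (h : ∀ j k, P.dirichlet j k → W j k = 0) (q : ℕ) :
    sineCoeff P.K (W 0) q = 0 :=
  sineCoeff_eq_zero (fun k _ hk => h 0 k ⟨⟨Nat.zero_le _, by omega⟩,
    fun h => absurd h.1 (by omega), fun h => absurd h.1 P.J_pos.ne⟩) q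

/-- The sine transform decouples the main step. -/
theorem MainStep.mainStepq {A B G : MeshFun} (h : P.MainStep A B G)
    (hA : ∀ j k, P.dirichlet j k → A j k = 0) (hB : ∀ j k, P.dirichlet j k → B j k = 0) {j : ℕ}
    (hj : 1 ≤ j) (hjJ : j ≤ P.J - 1) (q : ℕ) :
    P.MainStepq q (fun j => sineCoeff P.K (A j) q) (fun j => sineCoeff P.K (B j) q)
      (fun j => sineCoeff P.K (G j) q / P.sig q) j := by
  set D : MeshFun := fun j k => (B j k - A j k) / P.tau with hD
  set W : MeshFun := fun j k => (B j k + A j k) / 2 with hW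
  have hDrow : ∀ i, sineCoeff P.K (D i) q
      = (sineCoeff P.K (B i) q - sineCoeff P.K (A i) q) / P.tau := by
    intro i
    have : D i = (P.tau : ℂ)⁻¹ • (B i - A i) := by
      funext k; simp only [hD, Pi.smul_apply, Pi.sub_apply, smul_eq_mul]; ring
    rw [this, sineCoeff_smul, sineCoeff_sub]; ring
  have hWrow : ∀ i, sineCoeff P.K (W i) q
      = (sineCoeff P.K (B i) q + sineCoeff P.K (A i) q) / 2 := by
    intro i
    have : W i = (2 : ℂ)⁻¹ • (B i + A i) := by
      funext k; simp only [hW, Pi.smul_apply, Pi.add_apply, smul_eq_mul]; ring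
    rw [this, sineCoeff_smul, sineCoeff_add]; ring
  have hVrow : ∀ i, sineCoeff P.K (P.mulVt W i) q
      = P.VtMesh i * ((sineCoeff P.K (B i) q + sineCoeff P.K (A i) q) / 2) := by
    intro i
    have : P.mulVt W i = (P.VtMesh i : ℂ) • W i := rfl
    rw [this, sineCoeff_smul, hWrow]
  have hDs : ∀ i, i ≤ P.J → P.VanishesOnSides D i := fun i hi => by
    have h1 := vanishes_on_sides hA hi
    have h2 := vanishes_on_sides hB hi
    simp [VanishesOnSides, hD, h1.1, h1.2, h2.1, h2.2]
  have hWs : ∀ i, i ≤ P.J → P.VanishesOnSides W i := fun i hi => by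
    have h1 := vanishes_on_sides hA hi
    have h2 := vanishes_on_sides hB hi
    simp [VanishesOnSides, hW, h1.1, h1.2, h2.1, h2.2]
  have hVs : ∀ i, i ≤ P.J → P.VanishesOnSides (P.mulVt W) i := fun i hi => by
    have h1 := hWs i hi
    simp [VanishesOnSides, mulVt, h1.1, h1.2]
  have hrow : sineCoeff P.K ((Complex.I * P.hbar : ℂ) • sN P.hx P.hy D j) q
      = sineCoeff P.K ((-P.c : ℂ) • lapN P.hx P.hy W j + sN P.hx P.hy (P.mulVt W) j + G j) q :=
    sineCoeff_congr (fun k hk hkK => h j k ⟨hj, hjJ, hk, hkK⟩) q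
  have hs : (P.sig q : ℂ) ≠ 0 := by exact_mod_cast (P.sig_pos q).ne'
  rw [sineCoeff_add, sineCoeff_add, sineCoeff_smul, sineCoeff_smul,
    sineCoeff_sN (hDs j (by omega)), sineCoeff_sN (hVs j (by omega)), neg_mul,
    sineCoeff_lapN (hWs j (by omega)) (hWs _ (by omega)) (hWs _ (by omega))] at hrow
  simp only [hDrow, hWrow, hVrow] at hrow
  rw [MainStepq]
  refine mul_left_cancel₀ hs ?_
  have e : sTheta (P.theta q) P.hx (fun j => (P.VtMeshq q j : ℂ)
        * ((sineCoeff P.K (B j) q + sineCoeff P.K (A j) q) / 2)) j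
      = sTheta (P.theta q) P.hx (fun j => (P.VtMesh j : ℂ)
        * ((sineCoeff P.K (B j) q + sineCoeff P.K (A j) q) / 2)) j
        + P.c * (P.lam q / P.sig q) * sTheta (P.theta q) P.hx
          (fun j => (sineCoeff P.K (B j) q + sineCoeff P.K (A j) q) / 2) j := by
    rw [sTheta_eq P.hx_pos.ne', sTheta_eq P.hx_pos.ne', sTheta_eq P.hx_pos.ne']
    simp only [VtMeshq]
    push_cast
    ring
  rw [e]
  have e2 : (P.sig q : ℂ) * (sineCoeff P.K (G j) q / P.sig q) = sineCoeff P.K (G j) q := by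
    field_simp
  linear_combination hrow - e2

end Setup

/-! ### The energy over the half-strip -/

/-- Minkowski's inequality in disguise: it assembles the estimates for single frequencies, the cross
terms being handled by Cauchy–Schwarz. -/
theorem sqrt_sum_sq_le_add {ι : Type*} (s : Finset ι) {a b c : ι → ℝ} {r : ℝ} (hr : 0 ≤ r)
    (ha : ∀ i ∈ s, 0 ≤ a i) (hb : ∀ i ∈ s, 0 ≤ b i) (hc : ∀ i ∈ s, 0 ≤ c i)
    (h : ∀ i ∈ s, √(b i) ≤ √(a i) + r * √(c i)) :
    √(∑ i ∈ s, b i) ≤ √(∑ i ∈ s, a i) + r * √(∑ i ∈ s, c i) := by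
  have hA := Finset.sum_nonneg ha
  have hC := Finset.sum_nonneg hc
  rw [Real.sqrt_le_left (by positivity)]
  have h1 : ∑ i ∈ s, b i ≤ ∑ i ∈ s, (a i + 2 * r * (√(a i) * √(c i)) + r ^ 2 * c i) := by
    refine Finset.sum_le_sum fun i hi => ?_
    have := pow_le_pow_left₀ (Real.sqrt_nonneg _) (h i hi) 2
    nlinarith [Real.sq_sqrt (ha i hi), Real.sq_sqrt (hb i hi), Real.sq_sqrt (hc i hi)]
  have h2 : ∑ i ∈ s, √(a i) * √(c i) ≤ √(∑ i ∈ s, a i) * √(∑ i ∈ s, c i) := by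
    refine (Real.sum_mul_le_sqrt_mul_sqrt s _ _).trans_eq ?_
    rw [Finset.sum_congr rfl fun i hi => Real.sq_sqrt (ha i hi),
      Finset.sum_congr rfl fun i hi => Real.sq_sqrt (hc i hi)]
  rw [Finset.sum_add_distrib, Finset.sum_add_distrib, ← Finset.mul_sum, ← Finset.mul_sum] at h1
  nlinarith [Real.sq_sqrt hA, Real.sq_sqrt hC, mul_le_mul_of_nonneg_left h2 hr]

theorem coeff_mk_mul_mk (R Q : ℕ → ℂ) (m : ℕ) :
    PowerSeries.coeff m (PowerSeries.mk R * PowerSeries.mk Q) = conv R Q m := by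
  rw [PowerSeries.coeff_mul, Finset.Nat.sum_antidiagonal_eq_sum_range_succ
    (fun i j => PowerSeries.coeff i (PowerSeries.mk R) * PowerSeries.coeff j (PowerSeries.mk Q)),
    conv]
  simp only [PowerSeries.coeff_mk]

namespace Setup

variable {P : Setup}

variable (P) in
/-- The sum of squares of the sine coefficients of a mesh function and of its continuation beyond
the artificial boundary. -/
noncomputable def energy (Φ : ℕ → ℂ⟦X⟧) (k : ℕ) (W : MeshFun) : ℝ :=
  ∑ q ∈ Finset.Icc 1 (P.K - 1),
    (∑ j ∈ Finset.Icc 1 P.J, ‖sineCoeff P.K (W j) q‖ ^ 2 + P.tail q (Φ q) k)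

theorem sum_sineCoeff_sq (s : Finset ℕ) (W : MeshFun) :
    ∑ q ∈ Finset.Icc 1 (P.K - 1), ∑ j ∈ s, ‖sineCoeff P.K (W j) q‖ ^ 2
      = 2 / P.K * ∑ j ∈ s, ∑ k ∈ Finset.Icc 1 (P.K - 1), ‖W j k‖ ^ 2 := by
  rw [Finset.sum_comm, Finset.mul_sum]
  exact Finset.sum_congr rfl fun j _ => sum_norm_sineCoeff_sq _ _

theorem energy_eq (Φ : ℕ → ℂ⟦X⟧) (k : ℕ) (W : MeshFun) :
    P.energy Φ k W = 2 / P.K * ∑ j ∈ Finset.Icc 1 P.J, ∑ k ∈ Finset.Icc 1 (P.K - 1), ‖W j k‖ ^ 2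
      + ∑ q ∈ Finset.Icc 1 (P.K - 1), P.tail q (Φ q) k := by
  rw [energy, Finset.sum_add_distrib, sum_sineCoeff_sq]

theorem sum_tail_nonneg (Φ : ℕ → ℂ⟦X⟧) (k : ℕ) :
    0 ≤ ∑ q ∈ Finset.Icc 1 (P.K - 1), P.tail q (Φ q) k :=
  Finset.sum_nonneg fun q _ => P.tail_nonneg q _ _

/-- By Parseval the mesh part depends on the moduli at the nodes only, and the tail on `Φ` only. So
the half-steps with the potential leave the energy unchanged. -/
theorem energy_congr {Φ : ℕ → ℂ⟦X⟧} {k : ℕ} {W W' : MeshFun}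
    (h : ∀ j k, 1 ≤ j → j ≤ P.J → 1 ≤ k → k ≤ P.K - 1 → ‖W j k‖ = ‖W' j k‖) :
    P.energy Φ k W = P.energy Φ k W' := by
  rw [energy_eq, energy_eq]
  congr 2
  refine Finset.sum_congr rfl fun j hj => Finset.sum_congr rfl fun k hk => ?_
  rw [Finset.mem_Icc] at hj hk
  rw [h j k hj.1 hj.2 hk.1 hk.2]

variable (P) in
/-- The left-hand side of the transparent boundary condition. -/
noncomputable def tbcLhs (q : ℕ) (A B : MeshFun) : ℂ :=
  P.cq q * bwd P.hx (fun j => (sineCoeff P.K (B j) q + sineCoeff P.K (A j) q) / 2) P.J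
    - P.hx * sMinus (P.theta q)
      (fun j => Complex.I * P.hbar * ((sineCoeff P.K (B j) q - sineCoeff P.K (A j) q) / P.tau)
        - P.Vinfq q * ((sineCoeff P.K (A j) q + sineCoeff P.K (B j) q) / 2)) P.J

/-- Stability of the main step on the half-strip. -/
theorem MainStep.sqrt_energy_le {A B G : MeshFun} {Φ : ℕ → ℂ⟦X⟧} {k : ℕ} (h : P.MainStep A B G)
    (hA : ∀ j k, P.dirichlet j k → A j k = 0) (hB : ∀ j k, P.dirichlet j k → B j k = 0)
    (hΦA : ∀ q, PowerSeries.coeff k (Φ q) = sineCoeff P.K (A P.J) q)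
    (hΦB : ∀ q, PowerSeries.coeff (k + 1) (Φ q) = sineCoeff P.K (B P.J) q)
    (htbc : ∀ q, 1 ≤ q → q ≤ P.K - 1 → P.tbcLhs q A B
      = P.cq q * PowerSeries.coeff (k + 1) (PowerSeries.mk (P.R q) * Φ q)) :
    √(P.energy Φ (k + 1) B) ≤ √(P.energy Φ k A) + 3 * P.tau / P.hbar
      * √(∑ q ∈ Finset.Icc 1 (P.K - 1), ∑ j ∈ Finset.Icc 1 (P.J - 1),
        ‖sineCoeff P.K (G j) q‖ ^ 2) := by
  have ht := P.tau_pos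
  have hh := P.hbar_pos
  refine sqrt_sum_sq_le_add _ (by positivity)
    (fun q _ => add_nonneg (by positivity) (P.tail_nonneg q _ _))
    (fun q _ => add_nonneg (by positivity) (P.tail_nonneg q _ _))
    (fun q _ => by positivity) fun q hq => ?_
  rw [Finset.mem_Icc] at hq
  exact P.sqrt_energy_le (A := fun j => sineCoeff P.K (A j) q) (B := fun j => sineCoeff P.K (B j) q)
    (g := fun j => sineCoeff P.K (G j) q) (sineCoeff_left hA q) (sineCoeff_left hB q) (hΦA q)
    (hΦB q) (fun j h1 h2 => h.mainStepq hA hB h1 h2 q) (htbc q hq.1 hq.2)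

/-! ### The steps with the potential -/

theorem artificial_or_interior_iff {j k : ℕ} :
    P.interior j k ∨ P.artificial j k ↔ 1 ≤ j ∧ j ≤ P.J ∧ 1 ≤ k ∧ k ≤ P.K - 1 := by
  have := P.two_le_J
  rw [interior, artificial]
  omega

theorem dirichlet_iff {j k : ℕ} :
    P.dirichlet j k ↔ P.onMesh j k ∧ ¬(1 ≤ j ∧ j ≤ P.J ∧ 1 ≤ k ∧ k ≤ P.K - 1) := by
  rw [← artificial_or_interior_iff, dirichlet, not_or]

theorem dV_far {j k : ℕ} (hj : j = P.J) (hk : 1 ≤ k) (hkK : k ≤ P.K - 1) : P.dV j k = 0 := by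
  have hK := P.K_pos
  have hY := P.hy_pos
  have h1 : (0 : ℝ) < k := by exact_mod_cast hk
  have h2 : (k : ℝ) < P.K := by exact_mod_cast (by omega : k < P.K)
  have h3 : (P.K : ℝ) * P.hy = P.Y := mul_div_cancel₀ _ (by exact_mod_cast hK.ne')
  rw [dV, P.VtMesh_far (by omega), P.V_far _ _ (P.X0_le_node (by omega)) (by positivity)
    (by nlinarith), sub_self]

theorem potential_eq_iff (v : ℝ) (a b : ℂ) :
    Complex.I * P.hbar * ((b - a) / (P.tau / 2)) = v * ((b + a) / 2) ↔
      (((-(v / 2) : ℝ) : ℂ) + ((2 * P.hbar / P.tau : ℝ) : ℂ) * Complex.I) * b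
        = (((v / 2 : ℝ) : ℂ) + ((2 * P.hbar / P.tau : ℝ) : ℂ) * Complex.I) * a := by
  have ht : (P.tau : ℂ) ≠ 0 := by exact_mod_cast P.tau_pos.ne'
  rw [← sub_eq_zero, ← sub_eq_zero (b := _ * a)]
  refine Eq.congr ?_ rfl
  push_cast
  field_simp
  ring

theorem potential_factor_ne_zero (v : ℝ) :
    (v : ℂ) + ((2 * P.hbar / P.tau : ℝ) : ℂ) * Complex.I ≠ 0 := by
  intro h
  have := congrArg Complex.im h
  rw [Complex.add_im, Complex.ofReal_im, zero_add, Complex.im_ofReal_mul, Complex.I_im, mul_one]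
    at this
  exact (div_pos (mul_pos two_pos P.hbar_pos) P.tau_pos).ne' this

/-- The factors `-v/2 + is` and `v/2 + is`, with `v` and `s` real, have equal modulus. -/
theorem PotentialStep.norm_eq {A B : MeshFun} (h : P.PotentialStep A B) {j k : ℕ} (hj : 1 ≤ j)
    (hjJ : j ≤ P.J) (hk : 1 ≤ k) (hkK : k ≤ P.K - 1) : ‖B j k‖ = ‖A j k‖ := by
  have h1 := (potential_eq_iff _ _ _).1 (h j k (artificial_or_interior_iff.2 ⟨hj, hjJ, hk, hkK⟩))
  have h2 := congrArg norm h1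
  rw [norm_mul, norm_mul, Complex.norm_add_mul_I, Complex.norm_add_mul_I, neg_sq,
    ← Complex.norm_add_mul_I] at h2
  exact mul_left_cancel₀ (norm_ne_zero_iff.2 (potential_factor_ne_zero _)) h2

theorem PotentialStep.eq_of_far {A B : MeshFun} (h : P.PotentialStep A B) {k : ℕ}
    (hk : 1 ≤ k) (hkK : k ≤ P.K - 1) : B P.J k = A P.J k := by
  have h1 := (potential_eq_iff _ _ _).1
    (h P.J k (artificial_or_interior_iff.2 ⟨P.J_pos, le_rfl, hk, hkK⟩))
  rw [dV_far rfl hk hkK, zero_div, neg_zero] at h1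
  exact mul_left_cancel₀ (potential_factor_ne_zero 0) h1

theorem PotentialStep.unique {A A' B B' : MeshFun} (h : P.PotentialStep A B)
    (h' : P.PotentialStep A' B') {j k : ℕ} (hjk : P.interior j k ∨ P.artificial j k)
    (hA : A j k = A' j k) : B j k = B' j k := by
  have h1 := (potential_eq_iff _ _ _).1 (h j k hjk)
  have h2 := (potential_eq_iff _ _ _).1 (h' j k hjk)
  rw [hA, ← h2] at h1
  exact mul_left_cancel₀ (potential_factor_ne_zero _) h1

open Classical in
theorem exists_potentialStep (A : MeshFun) :
    ∃ B, P.PotentialStep A B ∧ ∀ j k, P.dirichlet j k → B j k = 0 := by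
  refine ⟨fun j k => if P.interior j k ∨ P.artificial j k then
    (((P.dV j k / 2 : ℝ) : ℂ) + ((2 * P.hbar / P.tau : ℝ) : ℂ) * Complex.I) * A j k /
      (((-(P.dV j k / 2) : ℝ) : ℂ) + ((2 * P.hbar / P.tau : ℝ) : ℂ) * Complex.I) else 0,
    fun j k h => ?_, fun j k h => ?_⟩
  · simp only [potential_eq_iff, if_pos h]
    rw [mul_div_cancel₀ _ (potential_factor_ne_zero _)]
  · exact if_neg (by have := h.2; tauto)

/-! ### Stability -/

theorem normTilde_eq (W : MeshFun) : P.normTilde W = √(P.hx * P.hy)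
    * √(∑ j ∈ Finset.Icc 1 P.J, ∑ k ∈ Finset.Icc 1 (P.K - 1), ‖W j k‖ ^ 2) := by
  rw [normTilde, ← Real.sqrt_mul (mul_pos P.hx_pos P.hy_pos).le]
  simp only [mul_assoc, ← Finset.sum_mul]
  rw [mul_comm, mul_assoc]

theorem normInt_eq (W : MeshFun) : P.normInt W = √(P.hx * P.hy)
    * √(∑ j ∈ Finset.Icc 1 (P.J - 1), ∑ k ∈ Finset.Icc 1 (P.K - 1), ‖W j k‖ ^ 2) := by
  rw [normInt, ← Real.sqrt_mul (mul_pos P.hx_pos P.hy_pos).le]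
  simp only [mul_assoc, ← Finset.sum_mul]
  rw [mul_comm, mul_assoc]

/-- The generating function of the boundary values of the `q`-th sine coefficient. -/
noncomputable def bdrySeries (P : Setup) (tl : ℕ → MeshFun) (q : ℕ) : ℂ⟦X⟧ :=
  PowerSeries.mk fun n => sineCoeff P.K (tl n P.J) q

/-- Both half-steps between the two main steps act trivially where `ΔV = 0`. Therefore one boundary
series serves as the old value at level `m` and as the new one at level `m + 1`. -/
theorem IsSolution.artificial_eq {F : ℕ → MeshFun} {Psi0 : MeshFun} {Psi br tl : ℕ → MeshFun}
    (h : P.IsSolution F Psi0 Psi br tl) (m : ℕ) {k : ℕ} (hk : 1 ≤ k) (hkK : k ≤ P.K - 1) :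
    br (m + 1) P.J k = tl m P.J k := by
  rw [(h.step_one (m + 1) (by omega)).eq_of_far hk hkK, Nat.add_sub_cancel]
  rcases m with _ | m
  · rw [h.initial _ _ ⟨le_rfl, by omega⟩, h.initial_tilde _ _ ⟨le_rfl, by omega⟩]
  · exact (h.step_three (m + 1) (by omega)).eq_of_far hk hkK

/-- The energy inequality for one time step of the splitting scheme. -/
theorem IsSolution.sqrt_energy_succ_le {F : ℕ → MeshFun} {Psi0 : MeshFun}
    {Psi br tl : ℕ → MeshFun} (h : P.IsSolution F Psi0 Psi br tl) (m : ℕ) :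
    √(P.energy (P.bdrySeries tl) (m + 1) (Psi (m + 1)))
      ≤ √(P.energy (P.bdrySeries tl) m (Psi m)) + 3 * P.tau / P.hbar
        * √(∑ q ∈ Finset.Icc 1 (P.K - 1), ∑ j ∈ Finset.Icc 1 (P.J - 1),
          ‖sineCoeff P.K (F (m + 1) j) q‖ ^ 2) := by
  have h1 : 1 ≤ m + 1 := by omega
  have e1 : P.energy (P.bdrySeries tl) (m + 1) (Psi (m + 1))
      = P.energy (P.bdrySeries tl) (m + 1) (tl (m + 1)) :=
    energy_congr fun j k a b c d => (h.step_three _ h1).norm_eq a b c d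
  have e2 : P.energy (P.bdrySeries tl) m (Psi m)
      = P.energy (P.bdrySeries tl) m (br (m + 1)) :=
    energy_congr fun j k a b c d => ((h.step_one _ h1).norm_eq a b c d).symm
  rw [e1, e2]
  refine (h.step_two _ h1).sqrt_energy_le (fun j k hd => (h.boundary _ h1 j k hd).1)
    (fun j k hd => (h.boundary _ h1 j k hd).2.1) (fun q => ?_) (fun q => ?_) fun q hq hqK => ?_
  · rw [bdrySeries, PowerSeries.coeff_mk]
    exact sineCoeff_congr (fun k hk hkK => (h.artificial_eq m hk hkK).symm) q
  · rw [bdrySeries, PowerSeries.coeff_mk]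
  · have := h.tbc _ h1 q hq hqK
    rw [bdrySeries, coeff_mk_mul_mk]
    exact this

theorem IsSolution.normTilde_le {F : ℕ → MeshFun} {Psi0 : MeshFun} {Psi br tl : ℕ → MeshFun}
    (h : P.IsSolution F Psi0 Psi br tl) (h0 : ∀ k, P.artificial P.J k → Psi0 P.J k = 0) (m : ℕ) :
    P.normTilde (Psi m) ≤ P.normTilde Psi0
      + 3 / P.hbar * ∑ n ∈ Finset.Icc 1 m, P.normInt (F n) * P.tau := by
  have hK : (0 : ℝ) < P.K := by exact_mod_cast P.K_pos
  have hh := P.hbar_pos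
  have ht := P.tau_pos
  set w := √(P.hx * P.hy) with hw
  have hw0 : 0 ≤ w := Real.sqrt_nonneg _
  -- The energy norm rescaled to undo Parseval's factor `2/K`. It dominates the mesh norm because
  -- the tail is nonnegative.
  set N : ℕ → ℝ := fun m => w * (√(P.K / 2) * √(P.energy (P.bdrySeries tl) m (Psi m))) with hN
  have hNle : ∀ m, P.normTilde (Psi m) ≤ N m := by
    intro m
    rw [normTilde_eq]
    refine mul_le_mul_of_nonneg_left ?_ hw0
    rw [← Real.sqrt_mul (by positivity), energy_eq]
    refine Real.sqrt_le_sqrt ?_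
    have := sum_tail_nonneg (P := P) (P.bdrySeries tl) m
    rw [mul_add, ← mul_assoc, show (P.K : ℝ) / 2 * (2 / P.K) = 1 by field_simp, one_mul]
    exact le_add_of_nonneg_right (by positivity)
  have hN0 : N 0 = P.normTilde Psi0 := by
    rw [normTilde_eq, hN]
    simp only
    rw [← Real.sqrt_mul (by positivity), energy_eq]
    -- Zero initial values on the column `j = J` kill the tail at level 0, so the estimate starts
    -- from the mesh norm itself.
    have e1 : ∑ q ∈ Finset.Icc 1 (P.K - 1), P.tail q (P.bdrySeries tl q) 0 = 0 := by
      refine Finset.sum_eq_zero fun q _ => P.tail_eq_zero q ?_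
      rw [bdrySeries, ← PowerSeries.coeff_zero_eq_constantCoeff_apply, PowerSeries.coeff_mk]
      refine sineCoeff_eq_zero (fun k hk hkK => ?_) q
      rw [h.initial_tilde _ _ ⟨le_rfl, by omega⟩, h0 k ⟨rfl, hk, hkK⟩]
    rw [e1, add_zero, ← mul_assoc, show (P.K : ℝ) / 2 * (2 / P.K) = 1 by field_simp, one_mul]
    congr 2
    refine Finset.sum_congr rfl fun j hj => Finset.sum_congr rfl fun k hk => ?_
    rw [Finset.mem_Icc] at hj hk
    rw [h.initial j k ⟨hj.2, by omega⟩]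
  have hNs : ∀ m, N (m + 1) ≤ N m + 3 / P.hbar * (P.normInt (F (m + 1)) * P.tau) := by
    intro m
    have h1 := mul_le_mul_of_nonneg_left
      (mul_le_mul_of_nonneg_left (h.sqrt_energy_succ_le m) (Real.sqrt_nonneg ((P.K : ℝ) / 2))) hw0
    refine h1.trans_eq ?_
    rw [normInt_eq, sum_sineCoeff_sq, Real.sqrt_mul (by positivity)]
    have e1 : √((P.K : ℝ) / 2) * √(2 / P.K) = 1 := by
      rw [← Real.sqrt_mul (by positivity), show (P.K : ℝ) / 2 * (2 / P.K) = 1 by field_simp,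
        Real.sqrt_one]
    set S := √(∑ j ∈ Finset.Icc 1 (P.J - 1), ∑ k ∈ Finset.Icc 1 (P.K - 1), ‖F (m + 1) j k‖ ^ 2)
    simp only [hN]
    linear_combination (w * (3 * P.tau / P.hbar * S)) * e1
  refine (hNle m).trans ?_
  induction m with
  | zero => simp [hN0]
  | succ m ih =>
    rw [Finset.sum_Icc_succ_top (by omega), mul_add]
    linarith [hNs m]

end Setup

namespace Setup

variable {P : Setup}

/-! ### Unique solvability of the main step -/

variable (P) in
/-- The difference of the left-hand and right-hand sides of the main step without the free term. -/
noncomputable def mainRes (A B : MeshFun) : MeshFun := fun j k =>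
  Complex.I * P.hbar * sN P.hx P.hy (fun j k => (B j k - A j k) / P.tau) j k
    - (-P.c * lapN P.hx P.hy (fun j k => (B j k + A j k) / 2) j k
      + sN P.hx P.hy (P.mulVt (fun j k => (B j k + A j k) / 2)) j k)

theorem mainStep_iff {A B G : MeshFun} :
    P.MainStep A B G ↔ ∀ j k, P.interior j k → P.mainRes A B j k = G j k :=
  forall₃_congr fun j k _ => by rw [mainRes, sub_eq_iff_eq_add, add_comm (G j k)]

theorem mainRes_add (A A' B B' : MeshFun) (j k : ℕ) :
    P.mainRes (A + A') (B + B') j k = P.mainRes A B j k + P.mainRes A' B' j k := by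
  simp only [mainRes, sN, lapN, sNx, sNy, dxx, dyy, fwd, bwd, mulVt, Pi.add_apply]
  ring

theorem mainRes_smul (a : ℂ) (A B : MeshFun) (j k : ℕ) :
    P.mainRes (a • A) (a • B) j k = a * P.mainRes A B j k := by
  simp only [mainRes, sN, lapN, sNx, sNy, dxx, dyy, fwd, bwd, mulVt, Pi.smul_apply, smul_eq_mul]
  ring

theorem mainRes_congr {A A' : MeshFun} (h : ∀ j k, P.onMesh j k → A j k = A' j k) (B : MeshFun)
    {j k : ℕ} (hjk : P.interior j k) : P.mainRes A B j k = P.mainRes A' B j k := by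
  obtain ⟨h1, h2, h3, h4⟩ := hjk
  have e : ∀ i l, i ≤ P.J → l ≤ P.K → A i l = A' i l := fun i l a b => h i l ⟨a, b⟩
  simp only [mainRes, sN, lapN, sNx, sNy, dxx, dyy, fwd, bwd, mulVt, Nat.add_sub_cancel]
  rw [e j k (by omega) (by omega), e (j + 1) k (by omega) (by omega),
    e (j - 1) k (by omega) (by omega), e j (k + 1) (by omega) (by omega),
    e j (k - 1) (by omega) (by omega), e (j + 1) (k + 1) (by omega) (by omega),
    e (j + 1) (k - 1) (by omega) (by omega), e (j - 1) (k + 1) (by omega) (by omega),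
    e (j - 1) (k - 1) (by omega) (by omega)]

theorem tbcLhs_add (q : ℕ) (A A' B B' : MeshFun) :
    P.tbcLhs q (A + A') (B + B') = P.tbcLhs q A B + P.tbcLhs q A' B' := by
  simp only [tbcLhs, bwd, sMinus, Pi.add_apply, sineCoeff_add]
  ring

theorem tbcLhs_smul (q : ℕ) (a : ℂ) (A B : MeshFun) :
    P.tbcLhs q (a • A) (a • B) = a * P.tbcLhs q A B := by
  simp only [tbcLhs, bwd, sMinus, Pi.smul_apply, sineCoeff_smul]
  ring

theorem tbcLhs_congr {A A' : MeshFun} (h : ∀ j k, P.onMesh j k → A j k = A' j k) (q : ℕ)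
    (B : MeshFun) : P.tbcLhs q A B = P.tbcLhs q A' B := by
  have e : ∀ j, j ≤ P.J → sineCoeff P.K (A j) q = sineCoeff P.K (A' j) q := fun j hj =>
    sineCoeff_congr (fun k _ hk => h j k ⟨hj, by omega⟩) q
  simp only [tbcLhs, bwd, sMinus, e P.J le_rfl, e (P.J - 1) (Nat.sub_le _ _)]

variable (P) in
/-- The linear part, with respect to `B`, of the main step and of the boundary condition. -/
noncomputable def stepOp : MeshFun →ₗ[ℂ] MeshFun where
  -- On the column `j = J` the second index is read as the frequency `q`: its `K - 1` unknowns match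
  -- the `K - 1` boundary conditions, and the system is square.
  toFun W j k := if j ≤ P.J - 1 then P.mainRes 0 W j k
    else P.tbcLhs k 0 W - P.cq k * (P.R k 0 * sineCoeff P.K (W P.J) k)
  map_add' W W' := by
    funext j k
    have h1 := mainRes_add (P := P) 0 0 W W' j k
    have h2 := tbcLhs_add (P := P) k 0 0 W W'
    rw [add_zero] at h1 h2
    simp only [Pi.add_apply, sineCoeff_add, h1, h2]
    split_ifs <;> ring
  map_smul' a W := by
    funext j k
    have h1 := mainRes_smul (P := P) a 0 W j k
    have h2 := tbcLhs_smul (P := P) k a 0 W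
    rw [smul_zero] at h1 h2
    simp only [Pi.smul_apply, sineCoeff_smul, h1, h2, RingHom.id_apply, smul_eq_mul]
    split_ifs <;> ring

variable (P) in
/-- The nodes where the solution is not prescribed. -/
def nodes : Finset (ℕ × ℕ) := Finset.Icc 1 P.J ×ˢ Finset.Icc 1 (P.K - 1)

theorem mem_nodes {j k : ℕ} :
    (j, k) ∈ P.nodes ↔ 1 ≤ j ∧ j ≤ P.J ∧ 1 ≤ k ∧ k ≤ P.K - 1 := by
  rw [nodes, Finset.mem_product, Finset.mem_Icc, Finset.mem_Icc, and_assoc]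

/-- The homogeneous step has only the trivial solution. -/
theorem eq_zero_of_stepOp_eq_zero {W : MeshFun} (hW : ∀ j k, P.dirichlet j k → W j k = 0)
    (h : ∀ j k, (j, k) ∈ P.nodes → P.stepOp W j k = 0) {j k : ℕ} (hjk : (j, k) ∈ P.nodes) :
    W j k = 0 := by
  have hJ := P.two_le_J
  have hmain : P.MainStep 0 W 0 := mainStep_iff.2 fun j k hi => by
    have := h j k (mem_nodes.2 (artificial_or_interior_iff.1 (Or.inl hi)))
    rwa [stepOp, LinearMap.coe_mk, AddHom.coe_mk, if_pos hi.2.1] at this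
  have hz : ∀ j q, sineCoeff P.K ((0 : MeshFun) j) q = 0 := fun j q =>
    sineCoeff_eq_zero (fun _ _ _ => rfl) q
  -- Zero boundary values at level 0 and those of `W` at level 1, so that the convolution has no
  -- memory and the initial tail vanishes.
  set Φ : ℕ → ℂ⟦X⟧ := fun q => PowerSeries.X * PowerSeries.C (sineCoeff P.K (W P.J) q) with hΦ
  have hstep := hmain.sqrt_energy_le (Φ := Φ) (k := 0) (fun _ _ _ => rfl) hW
    (fun q => by rw [hz, hΦ]; simp) (fun q => by
      simp only [hΦ]; rw [PowerSeries.coeff_succ_X_mul]; simp) fun q hq hqK => by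
    have := h P.J q (mem_nodes.2 ⟨by omega, le_rfl, hq, hqK⟩)
    rw [stepOp, LinearMap.coe_mk, AddHom.coe_mk, if_neg (by omega), sub_eq_zero] at this
    rw [this, hΦ]
    simp only
    rw [mul_left_comm (PowerSeries.mk _), PowerSeries.coeff_succ_X_mul, PowerSeries.coeff_mul_C, PowerSeries.coeff_mk]
  have e0 : P.energy Φ 0 0 = 0 := by
    rw [energy]
    refine Finset.sum_eq_zero fun q _ => ?_
    rw [P.tail_eq_zero q (by simp [hΦ]), add_zero]
    exact Finset.sum_eq_zero fun j _ => by rw [hz]; simp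
  rw [e0] at hstep
  simp only [hz] at hstep
  simp only [norm_zero, ne_eq, OfNat.ofNat_ne_zero, not_false_eq_true, zero_pow,
    Finset.sum_const_zero, Real.sqrt_zero, mul_zero, add_zero] at hstep
  have h1 := Real.sqrt_eq_zero'.1 (le_antisymm hstep (Real.sqrt_nonneg _))
  rw [energy_eq] at h1
  have hK : (0 : ℝ) < P.K := by exact_mod_cast P.K_pos
  have h2 : ∑ j ∈ Finset.Icc 1 P.J, ∑ k ∈ Finset.Icc 1 (P.K - 1), ‖W j k‖ ^ 2 ≤ 0 := by
    have h3 := sum_tail_nonneg (P := P) Φ (0 + 1)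
    have h4 : 0 < 2 / (P.K : ℝ) := by positivity
    by_contra hcon
    have := mul_pos h4 (not_le.1 hcon)
    linarith
  have h5 : ∑ j ∈ Finset.Icc 1 P.J, ∑ k ∈ Finset.Icc 1 (P.K - 1), ‖W j k‖ ^ 2 = 0 :=
    le_antisymm h2 (by positivity)
  rw [← Finset.sum_product', Finset.sum_eq_zero_iff_of_nonneg fun _ _ => by positivity] at h5
  have := h5 (j, k) hjk
  simpa using this

theorem eq_of_stepOp_eq {W W' : MeshFun} (hW : ∀ j k, P.dirichlet j k → W j k = 0)
    (hW' : ∀ j k, P.dirichlet j k → W' j k = 0)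
    (h : ∀ j k, (j, k) ∈ P.nodes → P.stepOp W j k = P.stepOp W' j k) {j k : ℕ}
    (hjk : P.onMesh j k) : W j k = W' j k := by
  by_cases hn : (j, k) ∈ P.nodes
  · refine sub_eq_zero.1 (eq_zero_of_stepOp_eq_zero (W := W - W') (fun j k hd => ?_)
      (fun j k hm => ?_) hn)
    · rw [Pi.sub_apply, Pi.sub_apply, hW j k hd, hW' j k hd, sub_zero]
    · rw [map_sub, Pi.sub_apply, Pi.sub_apply, h j k hm, sub_self]
  · have hd : P.dirichlet j k := dirichlet_iff.2 ⟨hjk, fun hh => hn (mem_nodes.2 hh)⟩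
    rw [hW j k hd, hW' j k hd]

/-- Extension by zero of a function on the nodes. -/
noncomputable def extendZero (P : Setup) : (P.nodes → ℂ) →ₗ[ℂ] MeshFun where
  toFun u j k := if h : (j, k) ∈ P.nodes then u ⟨(j, k), h⟩ else 0
  map_add' u v := by
    funext j k
    simp only [Pi.add_apply]
    split_ifs <;> simp
  map_smul' a u := by
    funext j k
    simp only [Pi.smul_apply]
    split_ifs <;> simp

theorem extendZero_dirichlet (u : P.nodes → ℂ) {j k : ℕ} (h : P.dirichlet j k) :
    P.extendZero u j k = 0 :=
  dif_neg fun hn => (dirichlet_iff.1 h).2 (mem_nodes.1 hn)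

/-- A square finite linear system with trivial kernel is solvable; extension by zero builds in the
Dirichlet values. -/
theorem exists_stepOp_eq (r : MeshFun) :
    ∃ W, (∀ j k, P.dirichlet j k → W j k = 0) ∧
      ∀ j k, (j, k) ∈ P.nodes → P.stepOp W j k = r j k := by
  let restr : MeshFun →ₗ[ℂ] (P.nodes → ℂ) :=
    { toFun := fun W n => W n.1.1 n.1.2
      map_add' := fun _ _ => rfl
      map_smul' := fun _ _ => rfl }
  let f : (P.nodes → ℂ) →ₗ[ℂ] (P.nodes → ℂ) := restr ∘ₗ P.stepOp ∘ₗ P.extendZero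
  have hinj : Function.Injective f := by
    rw [← LinearMap.ker_eq_bot, LinearMap.ker_eq_bot']
    intro u hu
    funext ⟨⟨j, k⟩, hn⟩
    have := eq_zero_of_stepOp_eq_zero (W := P.extendZero u)
      (fun j k hd => extendZero_dirichlet u hd) (fun j k hm => congrFun hu ⟨(j, k), hm⟩) hn
    rwa [extendZero, LinearMap.coe_mk, AddHom.coe_mk, dif_pos hn] at this
  obtain ⟨u, hu⟩ := LinearMap.injective_iff_surjective.1 hinj (restr r)
  exact ⟨P.extendZero u, fun j k hd => extendZero_dirichlet u hd,
    fun j k hm => congrFun hu ⟨(j, k), hm⟩⟩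

variable (P) in
/-- The part of the discrete convolution that involves the preceding levels only. -/
noncomputable def memory (tl : ℕ → MeshFun) (m q : ℕ) : ℂ :=
  ∑ p ∈ Finset.range m, P.R q (p + 1) * sineCoeff P.K (tl (m - (p + 1)) P.J) q

theorem conv_eq (tl : ℕ → MeshFun) (m q : ℕ) :
    conv (P.R q) (fun n => sineCoeff P.K (tl n P.J) q) m
      = P.R q 0 * sineCoeff P.K (tl m P.J) q + P.memory tl m q := by
  rw [conv, Finset.sum_range_succ', add_comm]
  rfl

theorem memory_congr {tl tl' : ℕ → MeshFun} {m : ℕ}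
    (h : ∀ n, n < m → ∀ j k, P.onMesh j k → tl n j k = tl' n j k) (q : ℕ) :
    P.memory tl m q = P.memory tl' m q := by
  refine Finset.sum_congr rfl fun p hp => ?_
  rw [Finset.mem_range] at hp
  rw [sineCoeff_congr (fun k _ hk => h (m - (p + 1)) (by omega) P.J k ⟨le_rfl, by omega⟩) q]

variable (P) in
/-- The right-hand side of the linear system for one step. -/
noncomputable def stepRhs (A G : MeshFun) (μ : ℕ → ℂ) : MeshFun := fun j k =>
  if j ≤ P.J - 1 then G j k - P.mainRes A 0 j k else P.cq k * μ k - P.tbcLhs k A 0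

theorem step_iff {A B G : MeshFun} {μ : ℕ → ℂ} :
    (P.MainStep A B G ∧ ∀ q, 1 ≤ q → q ≤ P.K - 1 → P.tbcLhs q A B
      = P.cq q * (P.R q 0 * sineCoeff P.K (B P.J) q + μ q)) ↔
      ∀ j k, (j, k) ∈ P.nodes → P.stepOp B j k = P.stepRhs A G μ j k := by
  have hJ := P.two_le_J
  have h1 : ∀ j k, P.mainRes A B j k = P.mainRes A 0 j k + P.mainRes 0 B j k := fun j k => by
    rw [← mainRes_add, add_zero, zero_add]
  have h2 : ∀ q, P.tbcLhs q A B = P.tbcLhs q A 0 + P.tbcLhs q 0 B := fun q => by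
    rw [← tbcLhs_add, add_zero, zero_add]
  rw [mainStep_iff]
  constructor
  · rintro ⟨hm, ht⟩ j k hn
    rw [mem_nodes] at hn
    rw [stepOp, LinearMap.coe_mk, AddHom.coe_mk, stepRhs]
    split_ifs with hj
    · have := hm j k ⟨hn.1, hj, hn.2.2⟩
      rw [h1] at this
      linear_combination this
    · have := ht k hn.2.2.1 hn.2.2.2
      rw [h2] at this
      linear_combination this
  · intro h
    refine ⟨fun j k hi => ?_, fun q hq hqK => ?_⟩
    · have := h j k (mem_nodes.2 (artificial_or_interior_iff.1 (Or.inl hi)))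
      rw [stepOp, LinearMap.coe_mk, AddHom.coe_mk, stepRhs, if_pos hi.2.1, if_pos hi.2.1] at this
      rw [h1]
      linear_combination this
    · have := h P.J q (mem_nodes.2 ⟨by omega, le_rfl, hq, hqK⟩)
      rw [stepOp, LinearMap.coe_mk, AddHom.coe_mk, stepRhs, if_neg (by omega),
        if_neg (by omega)] at this
      rw [h2]
      linear_combination this

theorem stepRhs_congr {A A' : MeshFun} (h : ∀ j k, P.onMesh j k → A j k = A' j k) (G : MeshFun)
    {μ μ' : ℕ → ℂ} (hμ : ∀ q, μ q = μ' q) {j k : ℕ} (hn : (j, k) ∈ P.nodes) :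
    P.stepRhs A G μ j k = P.stepRhs A' G μ' j k := by
  rw [mem_nodes] at hn
  rw [stepRhs, stepRhs, tbcLhs_congr h, hμ]
  split_ifs with hj
  · rw [mainRes_congr h _ ⟨hn.1, hj, hn.2.2⟩]
  · rfl

theorem IsSolution.stepOp_eq {F : ℕ → MeshFun} {Psi0 : MeshFun} {Psi br tl : ℕ → MeshFun}
    (h : P.IsSolution F Psi0 Psi br tl) {m : ℕ} (hm : 1 ≤ m) {j k : ℕ} (hn : (j, k) ∈ P.nodes) :
    P.stepOp (tl m) j k = P.stepRhs (br m) (F m) (P.memory tl m) j k :=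
  step_iff.1 ⟨h.step_two m hm, fun q hq hqK => by
    have := h.tbc m hm q hq hqK
    rw [conv_eq] at this
    exact this⟩ j k hn

theorem PotentialStep.unique_onMesh {A A' B B' : MeshFun} (h : P.PotentialStep A B)
    (h' : P.PotentialStep A' B') (hA : ∀ j k, P.onMesh j k → A j k = A' j k)
    (hB : ∀ j k, P.dirichlet j k → B j k = 0) (hB' : ∀ j k, P.dirichlet j k → B' j k = 0)
    {j k : ℕ} (hjk : P.onMesh j k) : B j k = B' j k := by
  by_cases hd : P.dirichlet j k
  · rw [hB j k hd, hB' j k hd]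
  · refine h.unique h' ?_ (hA j k hjk)
    by_contra hc
    exact hd ⟨hjk, fun hi => hc (Or.inl hi), fun ha => hc (Or.inr ha)⟩

/-- The induction is strong because the boundary condition remembers all preceding levels. -/
theorem IsSolution.unique {F : ℕ → MeshFun} {Psi0 : MeshFun}
    {Psi br tl Psi' br' tl' : ℕ → MeshFun} (h : P.IsSolution F Psi0 Psi br tl)
    (h' : P.IsSolution F Psi0 Psi' br' tl') (m : ℕ) :
    (∀ j k, P.onMesh j k → Psi m j k = Psi' m j k) ∧
      (∀ j k, P.onMesh j k → tl m j k = tl' m j k) ∧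
      (1 ≤ m → ∀ j k, P.onMesh j k → br m j k = br' m j k) := by
  induction m using Nat.strong_induction_on with
  | _ m ih =>
    rcases Nat.eq_zero_or_pos m with rfl | hm
    · refine ⟨fun j k hjk => ?_, fun j k hjk => ?_, fun h0 => absurd h0 (by omega)⟩
      · rw [h.initial j k hjk, h'.initial j k hjk]
      · rw [h.initial_tilde j k hjk, h'.initial_tilde j k hjk]
    · have hbr : ∀ j k, P.onMesh j k → br m j k = br' m j k := fun j k hjk =>
        (h.step_one m hm).unique_onMesh (h'.step_one m hm) (ih (m - 1) (by omega)).1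
          (fun j k hd => (h.boundary m hm j k hd).1) (fun j k hd => (h'.boundary m hm j k hd).1) hjk
      have htl : ∀ j k, P.onMesh j k → tl m j k = tl' m j k := fun j k hjk =>
        eq_of_stepOp_eq (fun j k hd => (h.boundary m hm j k hd).2.1)
          (fun j k hd => (h'.boundary m hm j k hd).2.1)
          (fun j k hn => by
            rw [h.stepOp_eq hm hn, h'.stepOp_eq hm hn]
            exact stepRhs_congr hbr _ (memory_congr fun n hnm => (ih n hnm).2.1) hn) hjk
      exact ⟨fun j k hjk => (h.step_three m hm).unique_onMesh (h'.step_three m hm) htl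
          (fun j k hd => (h.boundary m hm j k hd).2.2)
          (fun j k hd => (h'.boundary m hm j k hd).2.2) hjk, htl, fun _ => hbr⟩

end Setup

/-! ### Construction of a solution level by level -/

/-- Construction of a sequence each term of which depends on all the preceding ones. -/
theorem exists_seq_of_history {S : Type*} (s0 : S) (Q : ℕ → (ℕ → S) → S → Prop)
    (hex : ∀ m h, ∃ s, Q m h s)
    (hloc : ∀ m h h' s, (∀ n, n < m → h n = h' n) → Q m h s → Q m h' s) :
    ∃ f : ℕ → S, f 0 = s0 ∧ ∀ m, 1 ≤ m → Q m f (f m) := by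
  choose g hg using hex
  -- `H m` is the history up to level `m`, with the default `s0` beyond; later updates do not touch
  -- earlier levels, and the diagonal is the sequence sought.
  let H : ℕ → ℕ → S := fun m => Nat.rec (fun _ => s0)
    (fun m h => Function.update h (m + 1) (g (m + 1) h)) m
  have hH : ∀ m, H (m + 1) = Function.update (H m) (m + 1) (g (m + 1) (H m)) := fun _ => rfl
  have hstab : ∀ m n, n ≤ m → H m n = H n n := by
    intro m
    induction m with
    | zero => intro n hn; rw [Nat.le_zero.1 hn]
    | succ m ih =>
      intro n hn
      rcases Nat.lt_or_ge n (m + 1) with hlt | hge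
      · rw [hH, Function.update_of_ne hlt.ne, ih n (by omega)]
      · rw [le_antisymm hn hge]
  refine ⟨fun m => H m m, rfl, fun m hm => ?_⟩
  obtain ⟨m, rfl⟩ : ∃ n, m = n + 1 := ⟨m - 1, by omega⟩
  refine hloc (m + 1) (H m) _ _ (fun n hn => hstab m n (by omega)) ?_
  change Q (m + 1) (H m) (H (m + 1) (m + 1))
  rw [hH, Function.update_self]
  exact hg _ _

namespace Setup

variable {P : Setup}

theorem exists_isSolution (F : ℕ → MeshFun) (Psi0 : MeshFun) :
    ∃ Psi br tl : ℕ → MeshFun, P.IsSolution F Psi0 Psi br tl := by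
  obtain ⟨f, hf0, hf⟩ := exists_seq_of_history (S := MeshFun × MeshFun × MeshFun)
    (Psi0, Psi0, Psi0)
    (fun m h s => P.PotentialStep (h (m - 1)).1 s.2.1 ∧
      (∀ j k, (j, k) ∈ P.nodes → P.stepOp s.2.2 j k
        = P.stepRhs s.2.1 (F m) (P.memory (fun n => (h n).2.2) m) j k) ∧
      P.PotentialStep s.2.2 s.1 ∧
      -- The alternative `m = 0` secures dependence on earlier levels only: there `m - 1` is again
      -- 0, which is not an earlier level.
      (∀ j k, P.dirichlet j k → s.2.1 j k = 0 ∧ s.2.2 j k = 0 ∧ s.1 j k = 0) ∨ m = 0)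
    (fun m h => by
      obtain ⟨b, hb, hbd⟩ := exists_potentialStep (P := P) (h (m - 1)).1
      obtain ⟨t, htd, ht⟩ := exists_stepOp_eq (P := P)
        (P.stepRhs b (F m) (P.memory (fun n => (h n).2.2) m))
      obtain ⟨p, hp, hpd⟩ := exists_potentialStep (P := P) t
      exact ⟨(p, b, t), Or.inl ⟨hb, ht, hp,
        fun j k hd => ⟨hbd j k hd, htd j k hd, hpd j k hd⟩⟩⟩)
    (fun m h h' s hh hQ => by
      rcases Nat.eq_zero_or_pos m with hm | hm
      · exact Or.inr hm
      obtain ⟨h1, h2, h3⟩ := hQ.resolve_right hm.ne'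
      refine Or.inl ⟨hh (m - 1) (by omega) ▸ h1, fun j k hn => ?_, h3⟩
      rw [h2 j k hn]
      exact stepRhs_congr (fun _ _ _ => rfl) _
        (memory_congr fun n hn j k _ => by rw [hh n hn]) hn)
  have hf' := fun m (hm : 1 ≤ m) => (hf m hm).resolve_right (by omega)
  have hstep := fun m (hm : 1 ≤ m) => step_iff.2 (hf' m hm).2.1
  exact ⟨fun m => (f m).1, fun m => (f m).2.1, fun m => (f m).2.2,
    { step_one := fun m hm => (hf' m hm).1
      step_two := fun m hm => (hstep m hm).1
      step_three := fun m hm => (hf' m hm).2.2.1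
      boundary := fun m hm => (hf' m hm).2.2.2
      initial := fun j k _ => by rw [hf0]
      initial_tilde := fun j k _ => by rw [hf0]
      tbc := fun m hm q hq hqK => by
        have := (hstep m hm).2 q hq hqK
        rw [conv_eq (fun n => (f n).2.2)]
        exact this }⟩

end Setup

end SplitNumerov

theorem mainTheorem1 (P : SplitNumerov.Setup) (L α : ℝ) (hα0 : 0 ≤ α) (hα1 : α ≤ 1)
    (hV : ∀ x x' : ℝ, 0 ≤ x → x ≤ x' → x' ≤ P.X → |P.Vt x' - P.Vt x| ≤ L * |x' - x| ^ α)
    (hL : L * P.tau * P.hx ^ α < 8 * P.hbar)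
    (F : ℕ → SplitNumerov.MeshFun) (Psi0 : SplitNumerov.MeshFun)
    (hcompat : ∀ j k, P.dirichlet j k → Psi0 j k = 0) :
    -- existence
    (∃ Psi br tl : ℕ → SplitNumerov.MeshFun, P.IsSolution F Psi0 Psi br tl) ∧
    -- uniqueness, as mesh functions on the finite mesh
    (∀ Psi br tl Psi' br' tl' : ℕ → SplitNumerov.MeshFun,
      P.IsSolution F Psi0 Psi br tl → P.IsSolution F Psi0 Psi' br' tl' →
        ∀ j k, P.onMesh j k →
          (∀ m, Psi m j k = Psi' m j k) ∧
          (∀ m, 1 ≤ m → br m j k = br' m j k ∧ tl m j k = tl' m j k)) ∧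
    -- the stability bound
    ((∀ k, P.artificial P.J k → Psi0 P.J k = 0) →
      (∀ k, k ≤ P.K → Psi0 (P.J - 1) k = 0) →
      ∀ Psi br tl : ℕ → SplitNumerov.MeshFun, P.IsSolution F Psi0 Psi br tl →
        ∀ M, 1 ≤ M → ∀ m, m ≤ M →
          P.normTilde (Psi m) ≤ P.normTilde Psi0
            + 6 / P.hbar * ∑ n ∈ Finset.Icc 1 M, P.normInt (F n) * P.tau) := by
  refine ⟨SplitNumerov.Setup.exists_isSolution F Psi0, ?_, ?_⟩
  · intro Psi br tl Psi' br' tl' h h' j k hjk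
    exact ⟨fun m => (h.unique h' m).1 j k hjk,
      fun m hm => ⟨(h.unique h' m).2.2 hm j k hjk, (h.unique h' m).2.1 j k hjk⟩⟩
  · intro h0 _ Psi br tl h M _ m hm
    have hh := P.hbar_pos
    have hpos : ∀ n, 0 ≤ P.normInt (F n) * P.tau := fun n =>
      mul_nonneg (Real.sqrt_nonneg _) P.tau_pos.le
    refine (h.normTilde_le h0 m).trans (add_le_add le_rfl ?_)
    -- The constant `3/ħ` and the sum up to `m` are enlarged to `6/ħ` and the sum up to `M`.
    refine mul_le_mul (by gcongr; norm_num) ?_ (Finset.sum_nonneg fun n _ => hpos n)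
      (by positivity)
    exact Finset.sum_le_sum_of_subset_of_nonneg (Finset.Icc_subset_Icc le_rfl hm)
      fun n _ _ => hpos n
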